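/- Let $(\mathcal X,\mathcal F)$ be a measurable space, $\mathbf P_0$ a probability measure on it (the prior), $\mathbf f=(f_1,\dots,f_n):\mathcal X\to\mathbb R^n$ measurable (the features), and $x_0\in\mathcal X$. For $\boldsymbol\mu\in\mathbb R^n$ let $\mathcal Q(\boldsymbol\mu)$ be the set of probability measures $\mathbf Q$ on $\mathcal X$ with $\mathbf f$ integrable under $\mathbf Q$ and $\mathbf E_{\mathbf Q}\mathbf f=\boldsymbol\mu$, and let $\mathbf P_{\boldsymbol\mu}$ be a minimizer of the Kullback–Leibler divergence $D(\mathbf Q\,\|\,\mathbf P_0)$ over $\mathbf Q\in\mathcal Q(\boldsymbol\mu)$ (with $\mathbf P_{\boldsymbol\mu}:=\mathbf P_0$ if there is none). For $\boldsymbol\lambda\in\mathbb R^n$ with $Z_{\boldsymbol\lambda}=\int e^{\boldsymbol\lambda\cdot\mathbf f}\,d\mathbf P_0<\infty$ let $\mathbf Q_{\boldsymbol\lambda}(dx)=e^{\boldsymbol\lambda\cdot\mathbf f(x)}\,\mathbf P_0(dx)/Z_{\boldsymbol\lambda}$ be the Gibbs distribution. Let $\mathcal H\subseteq\mathbb R^n$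 be the affine subspace of all vectors satisfying every affine relation $v\cdot\boldsymbol\mu=c$ such that $v\cdot\mathbf f=c$ holds $\mathbf P_0$-a.s. (so $\mathcal H=\mathbb R^n$ if no nontrivial linear combination of the features is a.s. constant). Assume that every $\boldsymbol\mu\in\mathcal H$ in some neighbourhood of $\mathbf f(x_0)$ is the vector of expected features of a Gibbs distribution, and let $\mathbf P_\infty$ be a Gibbs distribution $\mathbf Q_{\boldsymbol\lambda_\infty}$, $\boldsymbol\lambda_\infty\in\mathbb R^n$, with $\mathbf E_{\mathbf P_\infty}\mathbf f=\mathbf f(x_0)$. Let $D_1,D_2,\dots$ be random data such that the estimates $\hat{\boldsymbol\mu}(D_k)\in\mathbb R^n$ are iid and square integrable with $E[\hat{\boldsymbol\mu}(D_k)]=\mathbf f(x_0)$ and $\mathrm{Var}[\hat{\boldsymbol\mu}(D_k)]=\boldsymbol\Sigma$, and such that $\hat{\boldsymbol\mu}(D_k)\in\mathcal H$ a.s. Put $\hat{\boldsymbol\mu}_N=\frac1N\sum_{k=1}^N\hat{\boldsymbol\mu}(D_k)$. Then, as $N\to\infty$, $$\sqrt N\,(\hat{\boldsymbol\mu}_N-\mathbf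 f(x_0))\xrightarrow{\ \mathcal L\ }N(0,\boldsymbol\Sigma).$$ Moreover, the probability that the minimization problem defining $\mathbf P_{\hat{\boldsymbol\mu}_N}$ has exactly one solution tends to $1$ (the outer probability of the complement tends to $0$), and $$\sqrt N\,(\mathbf P_{\hat{\boldsymbol\mu}_N}-\mathbf P_\infty)\xrightarrow{\ \mathcal L\ }\mathbf W$$ in the space of finite signed measures on $\mathcal X$ with the total variation topology, in the sense of Hoffmann-Jørgensen, that is, with upper and lower expectations of bounded continuous functionals on the left-hand side (in particular, $\sqrt N(\mathbf P_{\hat{\boldsymbol\mu}_N}(\mathsf A_i)-\mathbf P_\infty(\mathsf A_i))_{i\le m}$ converges in law to $(\mathbf W(\mathsf A_i))_{i\le m}$ in this sense for all $\mathsf A_1,\dots,\mathsf A_m\in\mathcal F$). Here $\mathbf W$ is a Gaussian random signed measure: $(\mathbf W(\mathsf A))_{\mathsf A\in\mathcal F}$ is a Gaussian process with $\mathbf W(\mathsf A)\sim N(0,C(\mathsf A,\mathsf A))$ and $\mathrm{Cov}(\mathbf W(\mathsf A),\mathbf W(\mathsf B))=C(\mathsf A,\mathsf B)$, where $$C(\mathsf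 A,\mathsf B)=h(\mathsf A)^{\top}\,G\,\boldsymbol\Sigma\,G^{\top}\,h(\mathsf B),\qquad h(\mathsf A)=\int_{\mathsf A}(\mathbf f(x)-\mathbf f(x_0))\,\mathbf P_\infty(dx),$$ and $G$ is any generalized inverse ($VGV=V$) of the covariance matrix $V=\mathrm{Cov}_{\mathbf P_\infty}(\mathbf f)$; thus $G=V^{-1}$ if $V$ is invertible. -/

import Mathlib

open MeasureTheory ProbabilityTheory InformationTheory Filter Topology
open scoped ENNReal NNReal Matrix RealInnerProductSpace

noncomputable section

namespace MaxEntPosterior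

variable {X : Type*} [MeasurableSpace X] {n : ℕ}

/-- `Q` is a feasible belief for the feature vector `m`: a probability measure under which the
features `f = (f₁, …, fₙ)` are integrable, with vector of expected features equal to `m`. -/
structure IsFeasible (f : X → EuclideanSpace ℝ (Fin n)) (m : EuclideanSpace ℝ (Fin n))
    (Q : Measure X) : Prop where
  isProb : IsProbabilityMeasure Q
  integrable : Integrable f Q
  mean_eq : ∫ x, f x ∂Q = m

/-- `P` minimizes the Kullback-Leibler divergence to the prior `P₀` among all feasible beliefs
for the feature vector `m`. -/
structure IsMinimizer (P₀ : Measure X) (f : X → EuclideanSpace ℝ (Fin n))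
    (m : EuclideanSpace ℝ (Fin n)) (P : Measure X) : Prop where
  feasible : IsFeasible f m P
  le : ∀ Q : Measure X, IsFeasible f m Q → klDiv P P₀ ≤ klDiv Q P₀

open Classical in
/-- The posterior `P_m`: the minimizer of the Kullback-Leibler divergence to `P₀` among the
feasible beliefs for `m`. When there is no minimizer the value is the prior. -/
def posterior (P₀ : Measure X) (f : X → EuclideanSpace ℝ (Fin n))
    (m : EuclideanSpace ℝ (Fin n)) : Measure X :=
  if h : ∃ P, IsMinimizer P₀ f m P then h.choose else P₀

instance isProbabilityMeasure_posterior (P₀ : Measure X) [IsProbabilityMeasure P₀]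
    (f : X → EuclideanSpace ℝ (Fin n)) (m : EuclideanSpace ℝ (Fin n)) :
    IsProbabilityMeasure (posterior P₀ f m) := by
  unfold posterior
  split_ifs with h
  · exact h.choose_spec.feasible.isProb
  · infer_instance

/-- The Gibbs distribution `Q_lam(dx) = exp (lam · f(x)) P₀(dx) / Z_lam`. -/
def gibbs (P₀ : Measure X) (f : X → EuclideanSpace ℝ (Fin n))
    (lam : EuclideanSpace ℝ (Fin n)) : Measure X :=
  P₀.tilted (fun x => ⟪lam, f x⟫)

instance isFiniteMeasure_gibbs (P₀ : Measure X) (f : X → EuclideanSpace ℝ (Fin n))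
    (lam : EuclideanSpace ℝ (Fin n)) : IsFiniteMeasure (gibbs P₀ f lam) := by
  unfold gibbs; infer_instance

/-- The Gibbs distribution with parameter `lam` is well defined (its normalizing constant is
finite) and has vector of expected features `m`. -/
structure IsGibbsParameter (P₀ : Measure X) (f : X → EuclideanSpace ℝ (Fin n))
    (m lam : EuclideanSpace ℝ (Fin n)) : Prop where
  integrable_exp : Integrable (fun x => Real.exp ⟪lam, f x⟫) P₀
  feasible : IsFeasible f m (gibbs P₀ f lam)

/-- The vectors satisfying every affine relation that the features satisfy `P₀`-almost surely.
It is the whole space if the features are affinely independent, that is, if no nontrivial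
linear combination of the features is `P₀`-almost surely constant. -/
def compatible (P₀ : Measure X) (f : X → EuclideanSpace ℝ (Fin n)) :
    Set (EuclideanSpace ℝ (Fin n)) :=
  {m | ∀ (v : EuclideanSpace ℝ (Fin n)) (c : ℝ), (∀ᵐ x ∂P₀, ⟪v, f x⟫ = c) → ⟪v, m⟫ = c}

/-- The covariance matrix of the features under `P`. -/
def featureCov (P : Measure X) (f : X → EuclideanSpace ℝ (Fin n)) :
    Matrix (Fin n) (Fin n) ℝ :=
  Matrix.of fun i j => cov[fun x => f x i, fun x => f x j; P]

/-- The vector `h(A) = ∫_A (f(x) - m) P(dx)`. -/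
def partialMoment (P : Measure X) (f : X → EuclideanSpace ℝ (Fin n))
    (m : EuclideanSpace ℝ (Fin n)) (A : Set X) : Fin n → ℝ :=
  fun i => ∫ x in A, (f x i - m i) ∂P

/-- The kernel `C(A, B) = h(A)ᵀ G S Gᵀ h(B)`. -/
def covKernel (P : Measure X) (f : X → EuclideanSpace ℝ (Fin n))
    (m : EuclideanSpace ℝ (Fin n)) (G S : Matrix (Fin n) (Fin n) ℝ) (A B : Set X) : ℝ :=
  partialMoment P f m A ⬝ᵥ ((G * S * Gᵀ) *ᵥ partialMoment P f m B)

/-- The average of the first `N` terms of a sequence of vectors. -/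
def sampleAverage (Y : ℕ → EuclideanSpace ℝ (Fin n)) (N : ℕ) : EuclideanSpace ℝ (Fin n) :=
  (N : ℝ)⁻¹ • ∑ k ∈ Finset.range N, Y k

/-- Continuity of a functional of signed measures for the total variation topology, the topology
of uniform convergence on the measurable sets. -/
def TVContinuous (Φ : SignedMeasure X → ℝ) : Prop :=
  ∀ ν : SignedMeasure X, ∀ ε > 0, ∃ δ > 0, ∀ ν' : SignedMeasure X,
    (∀ A : Set X, MeasurableSet A → |ν' A - ν A| ≤ δ) → |Φ ν' - Φ ν| ≤ ε

/-- Convergence in law of `V N` to `W` in the space of signed measures with the total variation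
topology: `W` is a Borel random element, and `𝔼 Φ(V N) → 𝔼 Φ(W)` for every bounded nonnegative
continuous functional `Φ`. `∫⁻` of a function that is not measurable is its lower integral; the
clause for `c - Φ` gives convergence of the upper integrals, so this is convergence in law in the
sense of Hoffmann-Jørgensen, and ordinary convergence in law if the `V N` are Borel. -/
structure TendstoInLawTV {Ω Ω' : Type*} [MeasurableSpace Ω] [MeasurableSpace Ω']
    (V : ℕ → Ω → SignedMeasure X) (Pr : Measure Ω) (W : Ω' → SignedMeasure X)
    (Pr' : Measure Ω') : Prop where
  aemeasurable_limit : ∀ Φ : SignedMeasure X → ℝ, TVContinuous Φ →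
    AEMeasurable (fun ω => Φ (W ω)) Pr'
  tendsto : ∀ (Φ : SignedMeasure X → ℝ) (c : ℝ), TVContinuous Φ → (∀ ν, 0 ≤ Φ ν ∧ Φ ν ≤ c) →
    Tendsto (fun N => ∫⁻ ω, ENNReal.ofReal (Φ (V N ω)) ∂Pr) atTop
      (𝓝 (∫⁻ ω, ENNReal.ofReal (Φ (W ω)) ∂Pr'))

/-- `W` is a centered Gaussian random signed measure with covariance kernel `C`: the variables
`W(A)`, `A` measurable, are jointly Gaussian, `W(A) ∼ N(0, C(A, A))`, and
`Cov (W(A), W(B)) = C(A, B)`. -/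
structure IsGaussianSignedMeasure {Ω' : Type*} [MeasurableSpace Ω']
    (W : Ω' → SignedMeasure X) (Pr' : Measure Ω') (C : Set X → Set X → ℝ) : Prop where
  isGaussianProcess : IsGaussianProcess (fun (A : {A : Set X // MeasurableSet A}) ω => W ω A) Pr'
  hasLaw : ∀ A : Set X, MeasurableSet A →
    HasLaw (fun ω => W ω A) (gaussianReal 0 (C A A).toNNReal) Pr'
  cov_eq : ∀ A B : Set X, MeasurableSet A → MeasurableSet B →
    cov[fun ω => W ω A, fun ω => W ω B; Pr'] = C A B

end MaxEntPosterior

end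

/-!
Write `m₀ = f x₀`, let `P = P_∞` be the Gibbs distribution with mean `m₀`, and `g = f - m₀`. The
theorem is a delta method for the map `m ↦ posterior P₀ f m`, taken with values in the signed
measures with the total variation topology. That map need not be measurable, and need not be
Gibbs-valued except near `m₀`.

* *The posterior is a Gibbs distribution* whenever the required mean is that of one: the
  divergences satisfy a Pythagorean identity (`toReal_klDiv_eq_add_klDiv_gibbs`), so the Gibbs
  distribution is the unique minimizer.

* *The features have exponential moments under `P`.* By assumption the mean can be moved from `m₀`
  a little in every compatible direction `e` by tilting `P` with some `exp ⟪κ, g⟫`, and then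
  `⟪κ, e⟫ > 0` (`inner_mean_tilted_pos`). Finitely many such `κ` suffice for all unit vectors `e`,
  by compactness, and this makes `exp (δ ‖g‖)` integrable for some `δ > 0`
  (`exists_integrable_exp_mul_norm`).

* *The posterior is differentiable at `m₀` in total variation* along the compatible subspace, with
  derivative `u ↦ ⟪G u, g⟫ P`. Exponential integrals are strictly differentiable in the parameter,
  the derivative of the mean being the covariance operator of `g`. This operator is only invertible
  modulo the directions in which the features are degenerate, and the compatible vectors are exactly
  those that differ from `m₀` by a vector orthogonal to these (`mem_compatible_iff`). Adding the
  projection onto the degenerate directions allows an application of the inverse function theorem on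
  the whole space (`exists_tilted_expansion`, `exists_posterior_expansion`).

* *Passage to the limit.* By the multivariate central limit theorem
  (`tendstoInDistribution_sampleAverage`) the rescaled sample average converges in distribution, so
  it is tight. The rescaled posterior is uniformly close to the linear image `limitMeasure` of the
  rescaled average as long as the latter stays bounded, and a bounded functional continuous in total
  variation is uniformly continuous near the image of a compact set. This gives the convergence of
  lower and upper expectations (`tendstoInLawTV_of_approx`). The limit is a linear image of a
  Gaussian vector, hence a Gaussian random signed measure (`isGaussianSignedMeasure_limitMeasure`).
-/

noncomputable section

namespace MaxEntPosterior

/-! ### The multivariate central limit theorem and tightness -/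

section CentralLimit

variable {Ω : Type*} [MeasurableSpace Ω] {n : ℕ} {Pr : Measure Ω}

lemma covariance_inner_eq_dotProduct_mulVec [IsFiniteMeasure Pr]
    {Y : Ω → EuclideanSpace ℝ (Fin n)} (hY : MemLp Y 2 Pr) {S : Matrix (Fin n) (Fin n) ℝ}
    (hS : ∀ i j, cov[fun ω => Y ω i, fun ω => Y ω j; Pr] = S i j)
    (x y : EuclideanSpace ℝ (Fin n)) :
    cov[fun ω => ⟪x, Y ω⟫, fun ω => ⟪y, Y ω⟫; Pr] = x ⬝ᵥ S *ᵥ y := by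
  have hYi (i : Fin n) : MemLp (fun ω => Y ω i) 2 Pr :=
    (EuclideanSpace.proj (𝕜 := ℝ) i).comp_memLp' hY
  have h1 (x : EuclideanSpace ℝ (Fin n)) (ω : Ω) : ⟪x, Y ω⟫ = ∑ i, x i * Y ω i := by
    simp [PiLp.inner_apply, mul_comm]
  simp only [h1]
  rw [covariance_fun_sum_fun_sum (fun i => (hYi i).const_mul _) (fun i => (hYi i).const_mul _)]
  simp only [covariance_const_mul_left, covariance_const_mul_right, hS, dotProduct,
    Matrix.mulVec, Finset.mul_sum]
  exact Finset.sum_congr rfl fun i _ => Finset.sum_congr rfl fun j _ => by ring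

lemma posSemidef_of_covariance [IsFiniteMeasure Pr]
    {Y : Ω → EuclideanSpace ℝ (Fin n)} (hY : MemLp Y 2 Pr) {S : Matrix (Fin n) (Fin n) ℝ}
    (hS : ∀ i j, cov[fun ω => Y ω i, fun ω => Y ω j; Pr] = S i j) : S.PosSemidef := by
  refine Matrix.PosSemidef.of_dotProduct_mulVec_nonneg ?_ fun x => ?_
  · ext i j
    simp [← hS, covariance_comm]
  · have h := covariance_inner_eq_dotProduct_mulVec hY hS (WithLp.toLp 2 x) (WithLp.toLp 2 x)
    have h2 : AEMeasurable (fun ω => ⟪WithLp.toLp 2 x, Y ω⟫) Pr :=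
      (hY.const_inner (WithLp.toLp 2 x)).aestronglyMeasurable.aemeasurable
    rw [covariance_self h2] at h
    simp [← h, variance_nonneg]

/-- The multivariate central limit theorem for the sample average. By Lévy's theorem it suffices
to follow the characteristic function at `t`, which is that of the scalar variables `⟪t, Y k⟫`
at `1`; the one-dimensional central limit theorem applies to those. -/
theorem tendstoInDistribution_sampleAverage [IsProbabilityMeasure Pr]
    {Y : ℕ → Ω → EuclideanSpace ℝ (Fin n)} (hindep : iIndepFun Y Pr)
    (hident : ∀ k, IdentDistrib (Y k) (Y 0) Pr Pr) (hL2 : MemLp (Y 0) 2 Pr)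
    {S : Matrix (Fin n) (Fin n) ℝ}
    (hS : ∀ i j, cov[fun ω => Y 0 ω i, fun ω => Y 0 ω j; Pr] = S i j) :
    TendstoInDistribution
      (fun (N : ℕ) ω => √(N : ℝ) • (sampleAverage (fun k => Y k ω) N - ∫ ω, Y 0 ω ∂Pr))
      atTop id (fun _ => Pr) (multivariateGaussian 0 S) := by
  have hY (k : ℕ) : AEMeasurable (Y k) Pr := (hident k).aemeasurable_fst
  have hmeas (N : ℕ) : AEMeasurable
      (fun ω => √(N : ℝ) • (sampleAverage (fun k => Y k ω) N - ∫ ω, Y 0 ω ∂Pr)) Pr := by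
    unfold sampleAverage
    have h := Finset.aemeasurable_fun_sum (Finset.range N) fun k _ => hY k
    exact ((h.const_smul (N : ℝ)⁻¹).sub_const _).const_smul √(N : ℝ)
  refine ⟨hmeas, aemeasurable_id, ProbabilityMeasure.tendsto_iff_tendsto_charFun.2 fun t => ?_⟩
  have hPS := posSemidef_of_covariance hL2 hS
  have hint : Integrable (Y 0) Pr := hL2.integrable (by norm_num)
  have hvar : Var[fun ω => ⟪t, Y 0 ω⟫; Pr] = t ⬝ᵥ S *ᵥ t := by
    rw [← covariance_self (hL2.const_inner t).aestronglyMeasurable.aemeasurable]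
    exact covariance_inner_eq_dotProduct_mulVec hL2 hS t t
  have hclt := tendstoInDistribution_inv_sqrt_mul_sum_sub (X := fun k ω => ⟪t, Y k ω⟫) (P := Pr)
    (P' := gaussianReal 0 Var[fun ω => ⟪t, Y 0 ω⟫; Pr].toNNReal) (Y := id) HasLaw.id
    (hL2.const_inner t)
    (hindep.comp (fun _ y => ⟪t, y⟫) fun _ => by fun_prop)
    (fun k => (hident k).comp (u := fun y => ⟪t, y⟫) (by fun_prop))
  have h1 := ProbabilityMeasure.tendsto_iff_tendsto_charFun.1 hclt.tendsto 1
  have h2 : charFun ((multivariateGaussian 0 S).map id) t =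
      charFun ((gaussianReal 0 Var[fun ω => ⟪t, Y 0 ω⟫; Pr].toNNReal).map id) 1 := by
    rw [Measure.map_id, Measure.map_id, charFun_multivariateGaussian hPS, charFun_gaussianReal,
      hvar, Real.coe_toNNReal _ (by rw [← hvar]; exact variance_nonneg _ _)]
    simp
  simp only [ProbabilityMeasure.coe_mk]
  rw [h2]
  refine h1.congr fun N => ?_
  simp only [ProbabilityMeasure.coe_mk]
  rw [charFun_apply, charFun_apply, integral_map (hclt.forall_aemeasurable N) (by fun_prop),
    integral_map (hmeas N) (by fun_prop)]
  refine integral_congr_ae (ae_of_all _ fun ω => ?_)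
  simp only [RCLike.inner_apply, conj_trivial, one_mul]
  congr 3
  rw [real_inner_comm, inner_smul_right, inner_sub_right, sampleAverage, inner_smul_right,
    inner_sum, integral_inner hint]
  rcases Nat.eq_zero_or_pos N with rfl | hN
  · simp
  · have h3 : (0 : ℝ) < √N := Real.sqrt_pos.2 (by exact_mod_cast hN)
    have h4 : (N : ℝ) = √N * √N := (Real.mul_self_sqrt (Nat.cast_nonneg N)).symm
    generalize √(N : ℝ) = s at *
    rw [h4]
    field_simp

/-- A sequence that converges in distribution is tight. -/
lemma exists_measure_norm_gt_le_of_tendstoInDistribution {E Ω' : Type*} [NormedAddCommGroup E]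
    [InnerProductSpace ℝ E] [FiniteDimensional ℝ E] [MeasurableSpace E] [BorelSpace E]
    [MeasurableSpace Ω'] [IsProbabilityMeasure Pr] {Pr' : Measure Ω'} [IsProbabilityMeasure Pr']
    {Z : ℕ → Ω → E} {Z' : Ω' → E}
    (h : TendstoInDistribution Z atTop Z' (fun _ => Pr) Pr') {ε : ℝ≥0∞} (hε : 0 < ε) :
    ∃ R : ℝ, ∀ N, Pr {ω | R < ‖Z N ω‖} ≤ ε := by
  have htight (μ : ℕ → ProbabilityMeasure E) (μ₀ : ProbabilityMeasure E)
      (hμ : Tendsto μ atTop (𝓝 μ₀)) :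
      IsTightMeasureSet (Set.range fun N => (μ N : Measure E)) :=
    isTightMeasureSet_of_tendsto_charFun (by fun_prop)
      (ProbabilityMeasure.tendsto_iff_tendsto_charFun.1 hμ)
  have hlim := tendsto_measure_norm_gt_of_isTightMeasureSet (htight _ _ h.tendsto)
  obtain ⟨R, hR⟩ := (hlim.eventually (ge_mem_nhds hε)).exists
  refine ⟨R, fun N => ?_⟩
  have h1 := le_trans (le_iSup₂ (f := fun (μ : Measure E) (_ : μ ∈ _) => μ {x | R < ‖x‖}) _
    (Set.mem_range_self N)) hR
  refine le_trans (le_of_eq ?_) h1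
  have hms : MeasurableSet {x : E | R < ‖x‖} := measurableSet_lt measurable_const measurable_norm
  exact (Measure.map_apply_of_aemeasurable (h.forall_aemeasurable N) hms).symm

end CentralLimit

/-! ### Gibbs distributions as unique minimizers of the divergence -/

section Minimizer

variable {X : Type*} [MeasurableSpace X] {n : ℕ} {P₀ : Measure X} [IsProbabilityMeasure P₀]
  {f : X → EuclideanSpace ℝ (Fin n)} {m lam : EuclideanSpace ℝ (Fin n)} {Q : Measure X}

lemma integral_inner_of_isFeasible (hQ : IsFeasible f m Q) (v : EuclideanSpace ℝ (Fin n)) :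
    ∫ x, ⟪v, f x⟫ ∂Q = ⟪v, m⟫ := by
  rw [integral_inner hQ.integrable, hQ.mean_eq]

lemma llr_gibbs_ae_eq (h : IsGibbsParameter P₀ f m lam) :
    llr (gibbs P₀ f lam) P₀ =ᵐ[gibbs P₀ f lam]
      fun x => ⟪lam, f x⟫ - Real.log (∫ x, Real.exp ⟪lam, f x⟫ ∂P₀) :=
  (tilted_absolutelyContinuous P₀ _).ae_le (log_rnDeriv_tilted_left_self h.integrable_exp)

lemma klDiv_gibbs_ne_top (h : IsGibbsParameter P₀ f m lam) :
    klDiv (gibbs P₀ f lam) P₀ ≠ ∞ :=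
  klDiv_ne_top (tilted_absolutelyContinuous P₀ _) <| (integrable_congr (llr_gibbs_ae_eq h)).2 <|
    (h.feasible.integrable.const_inner lam).sub (integrable_const _)

lemma toReal_klDiv_gibbs (h : IsGibbsParameter P₀ f m lam) :
    (klDiv (gibbs P₀ f lam) P₀).toReal =
      ⟪lam, m⟫ - Real.log (∫ x, Real.exp ⟪lam, f x⟫ ∂P₀) := by
  have := h.feasible.isProb
  rw [toReal_klDiv_of_measure_eq (μ := gibbs P₀ f lam) (tilted_absolutelyContinuous P₀ _) (by simp),
    integral_congr_ae (llr_gibbs_ae_eq h),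
    integral_sub (h.feasible.integrable.const_inner lam) (integrable_const _),
    integral_inner_of_isFeasible h.feasible]
  simp

/-- The Pythagorean identity: the excess of the divergence of a feasible belief over that of the
Gibbs distribution is its divergence from the Gibbs distribution. -/
lemma toReal_klDiv_eq_add_klDiv_gibbs (h : IsGibbsParameter P₀ f m lam)
    (hQ : IsFeasible f m Q) (hfin : klDiv Q P₀ ≠ ∞) :
    (klDiv Q P₀).toReal =
      (klDiv Q (gibbs P₀ f lam)).toReal + (klDiv (gibbs P₀ f lam) P₀).toReal := by
  have := hQ.isProb
  have := h.feasible.isProb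
  obtain ⟨hac, hint⟩ := klDiv_ne_top_iff.1 hfin
  have hacG : Q ≪ gibbs P₀ f lam := hac.trans (absolutelyContinuous_tilted h.integrable_exp)
  rw [toReal_klDiv_of_measure_eq hac (by simp), toReal_klDiv_of_measure_eq hacG (by simp),
    toReal_klDiv_gibbs h, gibbs, integral_llr_tilted_right hac
      (hQ.integrable.const_inner lam) h.integrable_exp hint, integral_inner_of_isFeasible hQ]
  ring

/-- A Gibbs distribution with vector of expected features `m` minimizes the Kullback-Leibler
divergence among the feasible beliefs for `m`. -/
lemma IsGibbsParameter.isMinimizer (h : IsGibbsParameter P₀ f m lam) :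
    IsMinimizer P₀ f m (gibbs P₀ f lam) := by
  refine ⟨h.feasible, fun Q hQ => ?_⟩
  by_cases hfin : klDiv Q P₀ = ∞
  · simp [hfin]
  rw [← ENNReal.toReal_le_toReal (klDiv_gibbs_ne_top h) hfin,
    toReal_klDiv_eq_add_klDiv_gibbs h hQ hfin]
  exact le_add_of_nonneg_left ENNReal.toReal_nonneg

lemma IsGibbsParameter.eq_gibbs_of_isMinimizer (h : IsGibbsParameter P₀ f m lam)
    (hQ : IsMinimizer P₀ f m Q) : Q = gibbs P₀ f lam := by
  have := hQ.feasible.isProb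
  have hle := hQ.le _ h.feasible
  have hfin : klDiv Q P₀ ≠ ∞ := ne_top_of_le_ne_top (klDiv_gibbs_ne_top h) hle
  obtain ⟨hac, hint⟩ := klDiv_ne_top_iff.1 hfin
  have hfinG : klDiv Q (gibbs P₀ f lam) ≠ ∞ :=
    klDiv_ne_top (hac.trans (absolutelyContinuous_tilted h.integrable_exp))
      (integrable_llr_tilted_right hac (hQ.feasible.integrable.const_inner lam) hint
        h.integrable_exp)
  have hle' := ENNReal.toReal_mono (klDiv_gibbs_ne_top h) hle
  rw [toReal_klDiv_eq_add_klDiv_gibbs h hQ.feasible hfin] at hle'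
  have h0 : (klDiv Q (gibbs P₀ f lam)).toReal = 0 :=
    le_antisymm (by linarith) ENNReal.toReal_nonneg
  rcases (ENNReal.toReal_eq_zero_iff _).1 h0 with h0 | h0
  · exact klDiv_eq_zero_iff.1 h0
  · exact absurd h0 hfinG

lemma IsGibbsParameter.existsUnique_isMinimizer (h : IsGibbsParameter P₀ f m lam) :
    ∃! P, IsMinimizer P₀ f m P :=
  ⟨_, h.isMinimizer, fun _ hQ => h.eq_gibbs_of_isMinimizer hQ⟩

lemma IsGibbsParameter.posterior_eq_gibbs (h : IsGibbsParameter P₀ f m lam) :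
    posterior P₀ f m = gibbs P₀ f lam := by
  have hex : ∃ P, IsMinimizer P₀ f m P := ⟨_, h.isMinimizer⟩
  rw [posterior, dif_pos hex]
  exact h.eq_gibbs_of_isMinimizer hex.choose_spec

end Minimizer

/-! ### Consequences of an exponential moment -/

section ExponentialModulus

variable {X E : Type*} [MeasurableSpace X] [NormedAddCommGroup E] {P : Measure X} {g : X → E}
  {δ : ℝ}

/-- One half of the exponent `δ` absorbs the polynomial factor. -/
lemma integrable_pow_mul_exp_mul_norm (hg : AEStronglyMeasurable g P)
    (hδ : 0 < δ) (hexp : Integrable (fun x => Real.exp (δ * ‖g x‖)) P) {η : ℝ} (hη : η ≤ δ / 2)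
    (k : ℕ) : Integrable (fun x => ‖g x‖ ^ k * Real.exp (η * ‖g x‖)) P := by
  refine (hexp.const_mul ((δ / 2)⁻¹ ^ k * (k.factorial : ℝ))).mono'
    ((hg.norm.pow k).mul (Real.continuous_exp.comp_aestronglyMeasurable (hg.norm.const_mul η)))
    (ae_of_all _ fun x => ?_)
  have hn := norm_nonneg (g x)
  have h1 := Real.pow_div_factorial_le_exp (δ / 2 * ‖g x‖) (by positivity) k
  rw [div_le_iff₀ (by positivity), mul_pow] at h1
  have h2 : Real.exp (η * ‖g x‖) ≤ Real.exp (δ / 2 * ‖g x‖) :=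
    Real.exp_le_exp.2 (mul_le_mul_of_nonneg_right hη hn)
  have h3 : Real.exp (δ * ‖g x‖) = Real.exp (δ / 2 * ‖g x‖) * Real.exp (δ / 2 * ‖g x‖) := by
    rw [← Real.exp_add]; ring_nf
  have h4 : ‖g x‖ ^ k = (δ / 2)⁻¹ ^ k * ((δ / 2) ^ k * ‖g x‖ ^ k) := by
    rw [← mul_assoc, ← mul_pow, inv_mul_cancel₀ (by positivity), one_pow, one_mul]
  rw [Real.norm_eq_abs, abs_of_nonneg (by positivity), h3]
  calc ‖g x‖ ^ k * Real.exp (η * ‖g x‖)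
      ≤ ‖g x‖ ^ k * Real.exp (δ / 2 * ‖g x‖) := by gcongr
    _ = (δ / 2)⁻¹ ^ k * ((δ / 2) ^ k * ‖g x‖ ^ k) * Real.exp (δ / 2 * ‖g x‖) := by rw [← h4]
    _ ≤ (δ / 2)⁻¹ ^ k * (Real.exp (δ / 2 * ‖g x‖) * k.factorial) * Real.exp (δ / 2 * ‖g x‖) := by
        gcongr
    _ = _ := by ring

/-- The modulus `ρ(η) = ∫ ‖g‖ (1 + ‖g‖) (exp (η ‖g‖) - 1)` that bounds the remainders of the
first order expansions of exponential integrals at parameters of norm at most `η`. -/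
def expModulus (P : Measure X) (g : X → E) (η : ℝ) : ℝ :=
  ∫ x, ‖g x‖ * (1 + ‖g x‖) * (Real.exp (η * ‖g x‖) - 1) ∂P

lemma integrable_expModulus (hg : AEStronglyMeasurable g P)
    (hδ : 0 < δ) (hexp : Integrable (fun x => Real.exp (δ * ‖g x‖)) P) {η : ℝ} (hη : η ≤ δ / 2) :
    Integrable (fun x => ‖g x‖ * (1 + ‖g x‖) * (Real.exp (η * ‖g x‖) - 1)) P := by
  have h {η : ℝ} (hη : η ≤ δ / 2) := integrable_pow_mul_exp_mul_norm hg hδ hexp hη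
  have h0 : (0 : ℝ) ≤ δ / 2 := by positivity
  refine ((((h hη 1).add (h hη 2)).sub (h h0 1)).sub (h h0 2)).congr (ae_of_all _ fun x => ?_)
  simp only [Pi.add_apply, Pi.sub_apply, zero_mul, Real.exp_zero]
  ring

lemma tendsto_expModulus (hg : AEStronglyMeasurable g P)
    (hδ : 0 < δ) (hexp : Integrable (fun x => Real.exp (δ * ‖g x‖)) P) :
    Tendsto (expModulus P g) (𝓝[≥] 0) (𝓝 0) := by
  have hlim : Tendsto (expModulus P g) (𝓝[≥] 0)
      (𝓝 (∫ x, ‖g x‖ * (1 + ‖g x‖) * (Real.exp (0 * ‖g x‖) - 1) ∂P)) := by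
    refine tendsto_integral_filter_of_dominated_convergence
      (fun x => ‖g x‖ * (1 + ‖g x‖) * (Real.exp (δ / 2 * ‖g x‖) - 1)) ?_ ?_
      (integrable_expModulus hg hδ hexp le_rfl) ?_
    · refine Eventually.of_forall fun η => ?_
      exact (hg.norm.mul (aestronglyMeasurable_const.add hg.norm)).mul
        ((Real.continuous_exp.comp_aestronglyMeasurable (hg.norm.const_mul η)).sub
          aestronglyMeasurable_const)
    · have h1 : ∀ᶠ η in 𝓝[≥] (0 : ℝ), η ≤ δ / 2 :=
        mem_nhdsWithin_of_mem_nhds (Iic_mem_nhds (by positivity))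
      filter_upwards [h1, self_mem_nhdsWithin] with η hη hη0
      refine ae_of_all _ fun x => ?_
      have hn := norm_nonneg (g x)
      have h2 : Real.exp (η * ‖g x‖) ≤ Real.exp (δ / 2 * ‖g x‖) :=
        Real.exp_le_exp.2 (mul_le_mul_of_nonneg_right hη hn)
      have h3 : 1 ≤ Real.exp (η * ‖g x‖) := Real.one_le_exp (mul_nonneg hη0 hn)
      rw [Real.norm_eq_abs, abs_of_nonneg (mul_nonneg (by positivity) (by linarith))]
      gcongr
    · refine ae_of_all _ fun x => ?_
      have : Continuous fun η : ℝ => ‖g x‖ * (1 + ‖g x‖) * (Real.exp (η * ‖g x‖) - 1) := by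
        fun_prop
      exact (this.tendsto 0).mono_left nhdsWithin_le_nhds
  simpa using hlim

lemma memLp_two_of_integrable_exp (hg : AEStronglyMeasurable g P)
    (hδ : 0 < δ) (hexp : Integrable (fun x => Real.exp (δ * ‖g x‖)) P) : MemLp g 2 P := by
  refine (memLp_two_iff_integrable_sq_norm hg).2 ?_
  simpa using integrable_pow_mul_exp_mul_norm hg hδ hexp (η := 0) (by positivity) 2

lemma integrable_of_integrable_exp (hg : AEStronglyMeasurable g P)
    (hδ : 0 < δ) (hexp : Integrable (fun x => Real.exp (δ * ‖g x‖)) P) : Integrable g P := by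
  have h := integrable_pow_mul_exp_mul_norm hg hδ hexp (η := 0) (by positivity) 1
  exact (integrable_norm_iff hg).1 (by simpa using h)

end ExponentialModulus

/-! ### Exponential integrals and their strict derivatives -/

section ExponentialFamily

variable {X E F : Type*} [MeasurableSpace X] [NormedAddCommGroup E] [InnerProductSpace ℝ E]
  [NormedAddCommGroup F] [NormedSpace ℝ F] {P : Measure X} {g : X → E} {δ : ℝ}

/-- The mean value inequality for `t ↦ exp t - t` on `[-M, M]`. -/
lemma abs_exp_sub_exp_sub_le {a b M : ℝ} (ha : |a| ≤ M) (hb : |b| ≤ M) :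
    |Real.exp a - Real.exp b - (a - b)| ≤ |a - b| * (Real.exp M - 1) := by
  have hderiv (t : ℝ) (_ : t ∈ Set.Icc (-M) M) :
      HasDerivWithinAt (fun t => Real.exp t - t) (Real.exp t - 1) (Set.Icc (-M) M) t :=
    ((Real.hasDerivAt_exp t).sub (hasDerivAt_id t)).hasDerivWithinAt
  have hbound (t : ℝ) (ht : t ∈ Set.Icc (-M) M) : ‖Real.exp t - 1‖ ≤ Real.exp M - 1 := by
    have h1 : Real.exp t ≤ Real.exp M := Real.exp_le_exp.2 ht.2
    have h2 : Real.exp (-M) ≤ Real.exp t := Real.exp_le_exp.2 ht.1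
    have h3 := Real.add_one_le_exp M
    have h4 := Real.add_one_le_exp (-M)
    rw [Real.norm_eq_abs, abs_le]
    constructor <;> linarith
  have h := (convex_Icc (-M) M).norm_image_sub_le_of_norm_hasDerivWithin_le hderiv hbound
    (abs_le.1 hb) (abs_le.1 ha)
  rw [Real.norm_eq_abs, Real.norm_eq_abs] at h
  calc |Real.exp a - Real.exp b - (a - b)| = |Real.exp a - a - (Real.exp b - b)| := by ring_nf
    _ ≤ _ := h
    _ = _ := mul_comm _ _

/-- If for every direction `e` of a finite-dimensional space that contains `g` there is a finite
exponential moment `∫ exp ⟪κ, g⟫` with `⟪κ, e⟫ > 0`, then by compactness of the unit sphere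
finitely many such `κ` control `exp (δ * ‖g‖)` for some `δ > 0`. -/
lemma exists_integrable_exp_mul_norm [FiniteDimensional ℝ E] [IsFiniteMeasure P]
    (hg : AEStronglyMeasurable g P) {L : Submodule ℝ E} (hgL : ∀ᵐ x ∂P, g x ∈ L)
    (h : ∀ e ∈ L, e ≠ 0 → ∃ κ : E, Integrable (fun x => Real.exp ⟪κ, g x⟫) P ∧ 0 < ⟪κ, e⟫) :
    ∃ δ > 0, Integrable (fun x => Real.exp (δ * ‖g x‖)) P := by
  have hcomp : IsCompact (Metric.sphere (0 : E) 1 ∩ L) :=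
    (isCompact_sphere 0 1).inter_right L.closed_of_finiteDimensional
  have hcov : ∃ δ > 0, ∃ T : Finset E, (∀ κ ∈ T, Integrable (fun x => Real.exp ⟪κ, g x⟫) P) ∧
      ∀ e ∈ Metric.sphere (0 : E) 1 ∩ L, ∃ κ ∈ T, δ ≤ ⟪κ, e⟫ := by
    classical
    refine hcomp.induction_on (p := fun s => ∃ δ > 0, ∃ T : Finset E,
      (∀ κ ∈ T, Integrable (fun x => Real.exp ⟪κ, g x⟫) P) ∧
        ∀ e ∈ s, ∃ κ ∈ T, δ ≤ ⟪κ, e⟫) ?_ ?_ ?_ ?_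
    · exact ⟨1, one_pos, ∅, by simp, by simp⟩
    · rintro s t hst ⟨δ, hδ, T, hT, hT'⟩
      exact ⟨δ, hδ, T, hT, fun e he => hT' e (hst he)⟩
    · rintro s t ⟨δ₁, hδ₁, T₁, hT₁, hs⟩ ⟨δ₂, hδ₂, T₂, hT₂, ht⟩
      refine ⟨min δ₁ δ₂, lt_min hδ₁ hδ₂, T₁ ∪ T₂, fun κ hκ => ?_, fun e he => ?_⟩
      · rcases Finset.mem_union.1 hκ with hκ | hκ
        exacts [hT₁ κ hκ, hT₂ κ hκ]
      · rcases he with he | he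
        · obtain ⟨κ, hκ, hle⟩ := hs e he
          exact ⟨κ, Finset.mem_union_left _ hκ, (min_le_left _ _).trans hle⟩
        · obtain ⟨κ, hκ, hle⟩ := ht e he
          exact ⟨κ, Finset.mem_union_right _ hκ, (min_le_right _ _).trans hle⟩
    · rintro e ⟨he1, heL⟩
      have he0 : e ≠ 0 := by
        rintro rfl
        simp at he1
      obtain ⟨κ, hκ, hpos⟩ := h e heL he0
      refine ⟨{e' | ⟪κ, e⟫ / 2 < ⟪κ, e'⟫}, mem_nhdsWithin_of_mem_nhds ?_, ⟪κ, e⟫ / 2,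
        half_pos hpos, {κ}, by simpa using hκ, fun e' he' => ⟨κ, by simp, le_of_lt he'⟩⟩
      exact (isOpen_lt continuous_const (by fun_prop)).mem_nhds (half_lt_self hpos)
  obtain ⟨δ, hδ, T, hT, hcov⟩ := hcov
  refine ⟨δ, hδ, ?_⟩
  have hbd : Integrable (fun x => 1 + ∑ κ ∈ T, Real.exp ⟪κ, g x⟫) P :=
    (integrable_const 1).add (integrable_finsetSum T hT)
  refine hbd.mono' (Real.continuous_exp.comp_aestronglyMeasurable (hg.norm.const_mul δ)) ?_
  filter_upwards [hgL] with x hx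
  rw [Real.norm_eq_abs, abs_of_pos (Real.exp_pos _)]
  have hsum : 0 ≤ ∑ κ ∈ T, Real.exp ⟪κ, g x⟫ := Finset.sum_nonneg fun _ _ => (Real.exp_pos _).le
  by_cases h0 : g x = 0
  · simp only [h0, norm_zero, mul_zero, Real.exp_zero] at hsum ⊢
    linarith
  · have hn : 0 < ‖g x‖ := norm_pos_iff.2 h0
    obtain ⟨κ, hκ, hle⟩ := hcov (‖g x‖⁻¹ • g x)
      ⟨by simp [norm_smul, hn.ne'], L.smul_mem _ hx⟩
    rw [inner_smul_right, inv_mul_eq_div, le_div_iff₀ hn] at hle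
    have h1 := Finset.single_le_sum (f := fun κ => Real.exp ⟪κ, g x⟫)
      (fun _ _ => (Real.exp_pos _).le) hκ
    have h2 := Real.exp_le_exp.2 hle
    linarith

lemma integrable_exp_inner_smul (hg : AEStronglyMeasurable g P)
    (hδ : 0 < δ) (hexp : Integrable (fun x => Real.exp (δ * ‖g x‖)) P)
    {φ : X → F} (hφ : AEStronglyMeasurable φ P) (hφg : ∀ x, ‖φ x‖ ≤ 1 + ‖g x‖)
    {θ : E} (hθ : ‖θ‖ ≤ δ / 2) : Integrable (fun x => Real.exp ⟪θ, g x⟫ • φ x) P := by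
  have h := integrable_pow_mul_exp_mul_norm hg hδ hexp hθ
  refine ((h 0).add (h 1)).mono' ((Real.continuous_exp.comp_aestronglyMeasurable
    (hg.const_inner)).smul hφ) (ae_of_all _ fun x => ?_)
  have h1 : Real.exp ⟪θ, g x⟫ ≤ Real.exp (‖θ‖ * ‖g x‖) :=
    Real.exp_le_exp.2 (real_inner_le_norm _ _)
  simp only [Pi.add_apply, norm_smul, Real.norm_eq_abs, abs_of_pos (Real.exp_pos _)]
  calc Real.exp ⟪θ, g x⟫ * ‖φ x‖ ≤ Real.exp (‖θ‖ * ‖g x‖) * (1 + ‖g x‖) := by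
        gcongr; exact hφg x
    _ = _ := by ring

lemma integrable_inner_smul (hg : AEStronglyMeasurable g P)
    (hδ : 0 < δ) (hexp : Integrable (fun x => Real.exp (δ * ‖g x‖)) P)
    {φ : X → F} (hφ : AEStronglyMeasurable φ P) (hφg : ∀ x, ‖φ x‖ ≤ 1 + ‖g x‖)
    (θ : E) : Integrable (fun x => ⟪θ, g x⟫ • φ x) P := by
  have h := integrable_pow_mul_exp_mul_norm hg hδ hexp (η := 0) (by positivity)
  refine (((h 1).add (h 2)).const_mul ‖θ‖).mono' (hg.const_inner.smul hφ)
    (ae_of_all _ fun x => ?_)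
  simp only [Pi.add_apply, norm_smul]
  calc ‖⟪θ, g x⟫‖ * ‖φ x‖ ≤ (‖θ‖ * ‖g x‖) * (1 + ‖g x‖) := by
        gcongr
        · exact norm_inner_le_norm _ _
        · exact hφg x
    _ = _ := by simp; ring

/-- First order expansion of exponential integrals, with an error that is uniform in the weight
`φ`; indicator functions as weights give expansions in total variation. -/
lemma norm_integral_exp_inner_sub_le (hg : AEStronglyMeasurable g P)
    (hδ : 0 < δ) (hexp : Integrable (fun x => Real.exp (δ * ‖g x‖)) P)
    {φ : X → F} (hφ : AEStronglyMeasurable φ P) (hφg : ∀ x, ‖φ x‖ ≤ 1 + ‖g x‖)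
    {η : ℝ} (hη : η ≤ δ / 2) {θ θ' : E} (hθ : ‖θ‖ ≤ η) (hθ' : ‖θ'‖ ≤ η) :
    ‖(∫ x, Real.exp ⟪θ, g x⟫ • φ x ∂P) - (∫ x, Real.exp ⟪θ', g x⟫ • φ x ∂P)
      - ∫ x, ⟪θ - θ', g x⟫ • φ x ∂P‖ ≤ expModulus P g η * ‖θ - θ'‖ := by
  have h1 := integrable_exp_inner_smul hg hδ hexp hφ hφg (hθ.trans hη)
  have h2 := integrable_exp_inner_smul hg hδ hexp hφ hφg (hθ'.trans hη)
  have h3 := integrable_inner_smul hg hδ hexp hφ hφg (θ - θ')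
  have hsub := integral_sub (h1.sub h2) h3
  simp only [Pi.sub_apply] at hsub
  rw [← integral_sub h1 h2, ← hsub, expModulus, ← integral_mul_const]
  refine norm_integral_le_of_norm_le ((integrable_expModulus hg hδ hexp hη).mul_const _)
    (ae_of_all _ fun x => ?_)
  have hn := norm_nonneg (g x)
  have hbd {θ : E} (hθ : ‖θ‖ ≤ η) : |⟪θ, g x⟫| ≤ η * ‖g x‖ :=
    (abs_real_inner_le_norm _ _).trans (mul_le_mul_of_nonneg_right hθ hn)
  have h4 := abs_exp_sub_exp_sub_le (hbd hθ) (hbd hθ')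
  rw [← inner_sub_left] at h4
  have h5 : 0 ≤ Real.exp (η * ‖g x‖) - 1 := by
    have := Real.one_le_exp (mul_nonneg ((norm_nonneg θ).trans hθ) hn)
    linarith
  rw [← sub_smul, ← sub_smul, norm_smul, Real.norm_eq_abs]
  calc |Real.exp ⟪θ, g x⟫ - Real.exp ⟪θ', g x⟫ - ⟪θ - θ', g x⟫| * ‖φ x‖
      ≤ (|⟪θ - θ', g x⟫| * (Real.exp (η * ‖g x‖) - 1)) * (1 + ‖g x‖) := by
        gcongr; exact hφg x
    _ ≤ ((‖θ - θ'‖ * ‖g x‖) * (Real.exp (η * ‖g x‖) - 1)) * (1 + ‖g x‖) := by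
        gcongr; exact abs_real_inner_le_norm _ _
    _ = _ := by ring

lemma hasStrictFDerivAt_integral_exp_inner_smul (hg : AEStronglyMeasurable g P)
    (hδ : 0 < δ) (hexp : Integrable (fun x => Real.exp (δ * ‖g x‖)) P)
    {φ : X → F} (hφ : AEStronglyMeasurable φ P) (hφg : ∀ x, ‖φ x‖ ≤ 1 + ‖g x‖)
    {D : E →L[ℝ] F} (hD : ∀ θ, D θ = ∫ x, ⟪θ, g x⟫ • φ x ∂P) :
    HasStrictFDerivAt (fun θ : E => ∫ x, Real.exp ⟪θ, g x⟫ • φ x ∂P) D 0 := by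
  refine .of_isLittleO (Asymptotics.isLittleO_iff.2 fun c hc => ?_)
  have h1 : ∀ᶠ η in 𝓝[≥] (0 : ℝ), η ≤ δ / 2 :=
    mem_nhdsWithin_of_mem_nhds (Iic_mem_nhds (by positivity))
  have h2 := (tendsto_expModulus hg hδ hexp).eventually (ge_mem_nhds hc)
  have h3 : Tendsto (fun p : E × E => max ‖p.1‖ ‖p.2‖) (𝓝 (0, 0)) (𝓝[≥] 0) := by
    refine tendsto_nhdsWithin_iff.2 ⟨?_, Eventually.of_forall fun p =>
      (norm_nonneg p.1).trans (le_max_left _ _)⟩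
    have : Continuous fun p : E × E => max ‖p.1‖ ‖p.2‖ := by fun_prop
    simpa using this.tendsto (0, 0)
  filter_upwards [h3.eventually h1, h3.eventually h2] with p hp1 hp2
  rw [hD]
  exact (norm_integral_exp_inner_sub_le hg hδ hexp hφ hφg hp1 (le_max_left _ _)
    (le_max_right _ _)).trans (mul_le_mul_of_nonneg_right hp2 (norm_nonneg _))

end ExponentialFamily

/-! ### The covariance operator and the inverse function theorem for the mean -/

section Covariance

variable {X E : Type*} [MeasurableSpace X] [NormedAddCommGroup E] [InnerProductSpace ℝ E]
  {P : Measure X} {g : X → E} {δ : ℝ}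

/-- The covariance operator `v ↦ ∫ ⟪v, g⟫ g dP` of a centered random vector `g`, as the integral of
rank one operators. It is `0` if `‖g‖ ^ 2` is not integrable. -/
def covOperator (P : Measure X) (g : X → E) : E →L[ℝ] E :=
  ∫ x, (innerSL ℝ (g x)).smulRight (g x) ∂P

/-- The directions `v` in which `g` is degenerate: `⟪v, g⟫ = 0` almost surely. -/
def nullDirections (P : Measure X) (g : X → E) : Submodule ℝ E where
  carrier := {v | ∀ᵐ x ∂P, ⟪v, g x⟫ = 0}
  zero_mem' := by simp
  add_mem' {v w} hv hw := by
    have h : ∀ᵐ x ∂P, ⟪v + w, g x⟫ = 0 := by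
      filter_upwards [hv, hw] with x hx hx'
      rw [inner_add_left, hx, hx', add_zero]
    exact h
  smul_mem' c v hv := by
    have h : ∀ᵐ x ∂P, ⟪c • v, g x⟫ = 0 := by
      filter_upwards [hv] with x hx
      rw [real_inner_smul_left, hx, mul_zero]
    exact h

lemma mem_nullDirections {v : E} : v ∈ nullDirections P g ↔ ∀ᵐ x ∂P, ⟪v, g x⟫ = 0 := Iff.rfl

lemma ae_mem_orthogonal_nullDirections [FiniteDimensional ℝ E] :
    ∀ᵐ x ∂P, g x ∈ (nullDirections P g)ᗮ := by
  set b := Module.finBasis ℝ (nullDirections P g)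
  have h : ∀ᵐ x ∂P, ∀ i, ⟪(b i : E), g x⟫ = 0 :=
    ae_all_iff.2 fun i => mem_nullDirections.1 (b i).2
  filter_upwards [h] with x hx v hv
  have h1 : v = ∑ i, b.repr ⟨v, hv⟩ i • (b i : E) := by
    have h2 := congrArg Subtype.val (b.sum_repr ⟨v, hv⟩)
    rw [Submodule.coe_sum] at h2
    exact h2.symm
  rw [h1, sum_inner]
  exact Finset.sum_eq_zero fun i _ => by rw [real_inner_smul_left, hx i, mul_zero]

lemma covOperator_apply (hg : MemLp g 2 P) (v : E) :
    covOperator P g v = ∫ x, ⟪v, g x⟫ • g x ∂P := by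
  have hint : Integrable (fun x => (innerSL ℝ (g x)).smulRight (g x)) P := by
    refine ((memLp_two_iff_integrable_sq_norm hg.1).1 hg).mono' ?_ (ae_of_all _ fun x => ?_)
    · have : Continuous fun y : E => (innerSL ℝ y).smulRight y := by fun_prop
      exact this.comp_aestronglyMeasurable hg.1
    · simp [sq]
  rw [covOperator, ContinuousLinearMap.integral_apply hint]
  simp [real_inner_comm]

lemma inner_covOperator [CompleteSpace E] (hg : MemLp g 2 P) (w v : E) :
    ⟪w, covOperator P g v⟫ = ∫ x, ⟪v, g x⟫ * ⟪w, g x⟫ ∂P := by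
  have hint : Integrable (fun x => ⟪v, g x⟫ • g x) P :=
    memLp_one_iff_integrable.1 (hg.smul (hg.const_inner v))
  rw [covOperator_apply hg, ← integral_inner hint]
  simp only [inner_smul_right]

lemma covOperator_mem_orthogonal [CompleteSpace E] (hg : MemLp g 2 P) (v : E) :
    covOperator P g v ∈ (nullDirections P g)ᗮ := by
  intro w hw
  rw [inner_covOperator hg]
  refine integral_eq_zero_of_ae ?_
  filter_upwards [mem_nullDirections.1 hw] with x hx
  simp [hx]

lemma mem_nullDirections_of_inner_covOperator [CompleteSpace E] (hg : MemLp g 2 P) {v : E}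
    (hv : ⟪v, covOperator P g v⟫ = 0) : v ∈ nullDirections P g := by
  rw [inner_covOperator hg, integral_eq_zero_iff_of_nonneg (fun x => mul_self_nonneg _)
    ((hg.const_inner v).integrable_mul (hg.const_inner v))] at hv
  filter_upwards [hv] with x hx
  exact mul_self_eq_zero.1 hx

lemma integrable_exp_inner (hg : AEStronglyMeasurable g P)
    (hδ : 0 < δ) (hexp : Integrable (fun x => Real.exp (δ * ‖g x‖)) P) {θ : E}
    (hθ : ‖θ‖ ≤ δ / 2) : Integrable (fun x => Real.exp ⟪θ, g x⟫) P := by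
  simpa using integrable_exp_inner_smul hg hδ hexp (φ := fun _ => (1 : ℝ))
    aestronglyMeasurable_const (fun x => by simp) hθ

/-- First order expansion of a tilted measure at the parameter `0`, uniformly over the
measurable sets, that is, in total variation. -/
lemma abs_tilted_real_sub_le [CompleteSpace E] [IsProbabilityMeasure P]
    (hg : AEStronglyMeasurable g P)
    (hδ : 0 < δ) (hexp : Integrable (fun x => Real.exp (δ * ‖g x‖)) P) (hmean : ∫ x, g x ∂P = 0)
    {θ : E} (hθ : ‖θ‖ ≤ δ / 2) {A : Set X} (hA : MeasurableSet A) :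
    |(P.tilted fun x => ⟪θ, g x⟫).real A - P.real A - ⟪θ, ∫ x in A, g x ∂P⟫| ≤
      2 * expModulus P g ‖θ‖ * ‖θ‖ := by
  have hZint := integrable_exp_inner hg hδ hexp hθ
  have hint := integrable_of_integrable_exp hg hδ hexp
  have := isProbabilityMeasure_tilted hZint
  have hexpand (A : Set X) (hA : MeasurableSet A) :
      |(∫ x in A, Real.exp ⟪θ, g x⟫ ∂P) - P.real A - ⟪θ, ∫ x in A, g x ∂P⟫| ≤
        expModulus P g ‖θ‖ * ‖θ‖ := by
    have h := norm_integral_exp_inner_sub_le hg hδ hexp (φ := A.indicator fun _ => (1 : ℝ))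
      (aestronglyMeasurable_const.indicator hA)
      (fun x => (norm_indicator_le_norm_self _ x).trans (by simp)) hθ (θ := θ) (θ' := 0) le_rfl
      (by simp)
    rw [Real.norm_eq_abs] at h
    have h1 (ψ : X → ℝ) : ∫ x, ψ x • A.indicator (fun _ => (1 : ℝ)) x ∂P = ∫ x in A, ψ x ∂P := by
      rw [← integral_indicator hA]
      congr with x
      by_cases hx : x ∈ A <;> simp [hx]
    simp only [h1, sub_zero, inner_zero_left, Real.exp_zero] at h
    rw [integral_inner hint.integrableOn] at h
    simpa using h
  have hZ := hexpand Set.univ .univ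
  simp only [setIntegral_univ, hmean, inner_zero_right, sub_zero, probReal_univ] at hZ
  have hA1 := hexpand A hA
  have hZpos : 0 < ∫ x, Real.exp ⟪θ, g x⟫ ∂P := integral_exp_pos hZint
  have hQ : (P.tilted fun x => ⟪θ, g x⟫).real A * ∫ x, Real.exp ⟪θ, g x⟫ ∂P =
      ∫ x in A, Real.exp ⟪θ, g x⟫ ∂P := by
    rw [measureReal_def, tilted_apply_eq_ofReal_integral' _ hA, ENNReal.toReal_ofReal
      (integral_nonneg fun x => by positivity), integral_div, div_mul_cancel₀ _ hZpos.ne']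
  have hQ1 : (P.tilted fun x => ⟪θ, g x⟫).real A ≤ 1 := measureReal_le_one
  have hQ0 : 0 ≤ (P.tilted fun x => ⟪θ, g x⟫).real A := measureReal_nonneg
  generalize (P.tilted fun x => ⟪θ, g x⟫).real A = q at *
  generalize ∫ x, Real.exp ⟪θ, g x⟫ ∂P = Z at *
  rw [← hQ] at hA1
  -- `q - P A` differs from the expansion of the numerator `q * Z` by the error `q * (Z - 1)`
  have h2 : |q * (Z - 1)| ≤ expModulus P g ‖θ‖ * ‖θ‖ := by
    rw [abs_mul, abs_of_nonneg hQ0]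
    exact (mul_le_of_le_one_left (abs_nonneg _) hQ1).trans hZ
  rw [abs_le] at hA1 h2 ⊢
  constructor <;> linarith [hA1.1, hA1.2, h2.1, h2.2]

/-- The inverse function theorem for the mean of an exponential family, and the resulting first
order expansion in total variation: a small `u` orthogonal to the null directions of the centered
random vector `g` is the mean of `g` under a tilted measure, which up to `o(‖u‖)` in total variation
equals `P + ⟪G u, g⟫ P` for every generalized inverse `G` of the covariance operator.

The mean of `g` only takes values orthogonal to the null directions. Adding the orthogonal
projection onto the null directions makes its derivative invertible on the whole space. -/
theorem exists_tilted_expansion [FiniteDimensional ℝ E] [IsProbabilityMeasure P]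
    (hg : AEStronglyMeasurable g P)
    (hδ : 0 < δ) (hexp : Integrable (fun x => Real.exp (δ * ‖g x‖)) P) (hmean : ∫ x, g x ∂P = 0)
    {G : E → E} (hG : ∀ w, covOperator P g (G (covOperator P g w)) = covOperator P g w)
    {ε : ℝ} (hε : 0 < ε) :
    ∃ r > 0, ∀ u ∈ (nullDirections P g)ᗮ, ‖u‖ < r → ∃ θ : E,
      Integrable (fun x => Real.exp ⟪θ, g x⟫) P ∧
      Integrable g (P.tilted fun x => ⟪θ, g x⟫) ∧
      ∫ x, g x ∂(P.tilted fun x => ⟪θ, g x⟫) = u ∧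
      ∀ A, MeasurableSet A →
        |(P.tilted fun x => ⟪θ, g x⟫).real A - P.real A - ⟪G u, ∫ x in A, g x ∂P⟫| ≤ ε * ‖u‖ := by
  have := FiniteDimensional.complete ℝ E
  have hL2 := memLp_two_of_integrable_exp hg hδ hexp
  have hint := integrable_of_integrable_exp hg hδ hexp
  set V := covOperator P g with hV
  set K := nullDirections P g with hK
  set Z : E → ℝ := fun θ => ∫ x, Real.exp ⟪θ, g x⟫ ∂P with hZdef
  set N : E → E := fun θ => ∫ x, Real.exp ⟪θ, g x⟫ • g x ∂P with hNdef
  have hZ0 : Z 0 = 1 := by simp [hZdef]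
  have hN0 : N 0 = 0 := by simp [hNdef, hmean]
  have hZ' : HasStrictFDerivAt Z (0 : E →L[ℝ] ℝ) 0 := by
    have h := hasStrictFDerivAt_integral_exp_inner_smul hg hδ hexp (φ := fun _ => (1 : ℝ))
      aestronglyMeasurable_const (fun x => by simp) (D := (0 : E →L[ℝ] ℝ)) fun θ => by
        simp [integral_inner hint, hmean]
    simpa using h
  have hN' : HasStrictFDerivAt N V 0 :=
    hasStrictFDerivAt_integral_exp_inner_smul hg hδ hexp hg (fun x => by simp)
      fun θ => covOperator_apply hL2 θ
  set A : E →L[ℝ] E := V + K.starProjection with hA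
  have hsplit {u v w : E} (hu : u ∈ Kᗮ) (hv : v ∈ Kᗮ) (h : v + K.starProjection w = u) :
      v = u := by
    have h1 : K.starProjection w ∈ Kᗮ := by
      rw [← sub_eq_of_eq_add' h.symm]
      exact Kᗮ.sub_mem hu hv
    have h2 : K.starProjection w = 0 :=
      inner_self_eq_zero.1 (h1 _ (K.starProjection_apply_mem w))
    rw [← h, h2, add_zero]
  have hinj : Function.Injective (A : E →ₗ[ℝ] E) := by
    rw [← LinearMap.ker_eq_bot, LinearMap.ker_eq_bot']
    intro v hv
    have h1 : V v + K.starProjection v = 0 := hv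
    have h2 : V v = 0 := hsplit Kᗮ.zero_mem (covOperator_mem_orthogonal hL2 v) h1
    have h3 : v ∈ K :=
      mem_nullDirections_of_inner_covOperator hL2 (by rw [← hV, h2, inner_zero_right])
    rw [h2, zero_add, Submodule.starProjection_eq_self_iff.2 h3] at h1
    exact h1
  set e : E ≃L[ℝ] E := (LinearEquiv.ofInjectiveEndo (A : E →ₗ[ℝ] E) hinj).toContinuousLinearEquiv
    with he
  have heA (v : E) : e v = A v := rfl
  set M : E → E := fun θ => (Z θ)⁻¹ • N θ + K.starProjection θ with hM
  have hM0 : M 0 = 0 := by simp [hM, hN0]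
  have hM' : HasStrictFDerivAt M (e : E →L[ℝ] E) 0 := by
    have hinv : HasStrictFDerivAt (fun θ => (Z θ)⁻¹) (0 : E →L[ℝ] ℝ) 0 := by
      have h := (hasStrictDerivAt_inv (x := Z 0) (by simp [hZ0])).comp_hasStrictFDerivAt 0 hZ'
      simpa [Function.comp_def] using h
    have h : HasStrictFDerivAt M _ 0 :=
      (hinv.smul hN').add K.starProjection.hasStrictFDerivAt
    refine h.congr_fderiv ?_
    ext v
    simp [heA, hA, hZ0]
  set T : E → E := hM'.localInverse M e 0 with hT
  have hT' : HasStrictFDerivAt T (e.symm : E →L[ℝ] E) 0 := by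
    have := hM'.to_localInverse
    rwa [hM0] at this
  have hT0 : T 0 = 0 := by
    have := hM'.localInverse_apply_image
    rwa [hM0] at this
  have hright : ∀ᶠ u in 𝓝 (0 : E), M (T u) = u := by
    have := hM'.eventually_right_inverse
    rwa [hM0] at this
  set B : ℝ := ∫ x, ‖g x‖ ∂P with hB
  have hB0 : 0 ≤ B := integral_nonneg fun x => norm_nonneg _
  set C : ℝ := ‖(e.symm : E →L[ℝ] E)‖ + 1 with hC
  have hC0 : 0 < C := by positivity
  set c : ℝ := min 1 (ε / (2 * (1 + B))) with hc
  have hc0 : 0 < c := lt_min one_pos (by positivity)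
  have hlin : ∀ᶠ u in 𝓝 (0 : E), ‖T u - e.symm u‖ ≤ c * ‖u‖ := by
    have := Asymptotics.isLittleO_iff.1 hT'.hasFDerivAt.isLittleO hc0
    simpa [hT0] using this
  have hTlim : Tendsto (fun u => ‖T u‖) (𝓝 0) (𝓝 0) := by
    simpa [hT0] using hT'.hasFDerivAt.continuousAt.norm.tendsto
  have hsmall : ∀ᶠ u in 𝓝 (0 : E), ‖T u‖ ≤ δ / 2 :=
    hTlim.eventually (ge_mem_nhds (by positivity))
  have hmod : ∀ᶠ u in 𝓝 (0 : E), expModulus P g ‖T u‖ ≤ ε / (4 * C) := by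
    have hTlim' : Tendsto (fun u => ‖T u‖) (𝓝 0) (𝓝[≥] 0) :=
      tendsto_nhdsWithin_iff.2 ⟨hTlim, Eventually.of_forall fun u => norm_nonneg _⟩
    exact ((tendsto_expModulus hg hδ hexp).comp hTlim').eventually (ge_mem_nhds (by positivity))
  obtain ⟨r, hr, hball⟩ := Metric.eventually_nhds_iff.1
    (hright.and (hlin.and (hsmall.and hmod)))
  refine ⟨r, hr, fun u huL hur => ?_⟩
  obtain ⟨h1, h2, h3, h4⟩ := hball (y := u) (by simpa using hur)
  have hZint := integrable_exp_inner hg hδ hexp h3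
  have hNint := integrable_exp_inner_smul hg hδ hexp hg (fun x => by simp) h3
  refine ⟨T u, hZint, (integrable_tilted_iff hZint _).2 hNint, ?_, fun S hS => ?_⟩
  · have hmem : (Z (T u))⁻¹ • N (T u) ∈ Kᗮ := by
      refine Kᗮ.smul_mem _ fun w hw => ?_
      rw [hNdef, ← integral_inner hNint]
      refine integral_eq_zero_of_ae ?_
      filter_upwards [mem_nullDirections.1 hw] with x hx
      simp [inner_smul_right, hx]
    refine Eq.trans ?_ (hsplit huL hmem h1)
    simp only [integral_tilted, hNdef, ← integral_smul, smul_smul, div_eq_inv_mul, hZdef]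
  · have hh : ‖∫ x in S, g x ∂P‖ ≤ B :=
      (norm_integral_le_integral_norm _).trans
        (setIntegral_le_integral hint.norm (ae_of_all _ fun x => norm_nonneg _))
    -- `G u` and the derivative `e.symm u` differ by a null direction
    have hGu : ⟪G u, ∫ x in S, g x ∂P⟫ = ⟪e.symm u, ∫ x in S, g x ∂P⟫ := by
      have hVw : V (e.symm u) = u := by
        refine hsplit (w := e.symm u) huL (covOperator_mem_orthogonal hL2 _) ?_
        exact e.apply_symm_apply u
      have hdiff : G u - e.symm u ∈ K := by
        refine mem_nullDirections_of_inner_covOperator hL2 ?_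
        have h5 := hG (e.symm u)
        rw [hVw] at h5
        rw [← hV, map_sub, h5, hVw, sub_self, inner_zero_right]
      rw [← sub_eq_zero, ← inner_sub_left, ← integral_inner hint.integrableOn]
      exact integral_eq_zero_of_ae (ae_restrict_of_ae (mem_nullDirections.1 hdiff))
    have h5 := abs_tilted_real_sub_le hg hδ hexp hmean h3 hS
    have h6 : ‖T u‖ ≤ C * ‖u‖ := by
      calc ‖T u‖ = ‖(T u - e.symm u) + e.symm u‖ := by rw [sub_add_cancel]
        _ ≤ ‖T u - e.symm u‖ + ‖e.symm u‖ := norm_add_le _ _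
        _ ≤ 1 * ‖u‖ + ‖(e.symm : E →L[ℝ] E)‖ * ‖u‖ := by
            gcongr
            · exact h2.trans (by gcongr; exact min_le_left _ _)
            · exact (e.symm : E →L[ℝ] E).le_opNorm u
        _ = C * ‖u‖ := by ring
    have h7 : 2 * expModulus P g ‖T u‖ * ‖T u‖ ≤ ε / 2 * ‖u‖ := by
      calc 2 * expModulus P g ‖T u‖ * ‖T u‖ ≤ 2 * (ε / (4 * C)) * (C * ‖u‖) := by gcongr
        _ = ε / 2 * ‖u‖ := by field_simp; ring
    have h8 : |⟪T u - e.symm u, ∫ x in S, g x ∂P⟫| ≤ ε / 2 * ‖u‖ := by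
      calc |⟪T u - e.symm u, ∫ x in S, g x ∂P⟫|
          ≤ ‖T u - e.symm u‖ * ‖∫ x in S, g x ∂P‖ := abs_real_inner_le_norm _ _
        _ ≤ (c * ‖u‖) * (1 + B) := by gcongr; linarith
        _ ≤ (ε / (2 * (1 + B)) * ‖u‖) * (1 + B) := by gcongr; exact min_le_right _ _
        _ = ε / 2 * ‖u‖ := by field_simp
    rw [hGu]
    rw [inner_sub_left] at h8
    rw [abs_le] at h5 h8 ⊢
    constructor <;> linarith [h5.1, h5.2, h8.1, h8.2]

end Covariance

/-! ### The direction in which a tilting moves the mean -/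

section Interior

variable {X E : Type*} [MeasurableSpace X] [NormedAddCommGroup E] [InnerProductSpace ℝ E]
  [CompleteSpace E] {P : Measure X} {g : X → E}

/-- Tilting a centered random vector `g` by `⟪κ, g⟫` moves its mean strictly in the direction
of `κ`, unless it does not move it at all. -/
lemma inner_mean_tilted_pos [IsProbabilityMeasure P] (hg : Integrable g P)
    (hmean : ∫ x, g x ∂P = 0) {κ u : E} (hexp : Integrable (fun x => Real.exp ⟪κ, g x⟫) P)
    (hgκ : Integrable g (P.tilted fun x => ⟪κ, g x⟫))
    (hu : ∫ x, g x ∂(P.tilted fun x => ⟪κ, g x⟫) = u) (hu0 : u ≠ 0) : 0 < ⟪κ, u⟫ := by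
  have hZ := integral_exp_pos hexp
  have h1 : Integrable (fun x => Real.exp ⟪κ, g x⟫ * ⟪κ, g x⟫) P :=
    (integrable_tilted_iff hexp _).1 (hgκ.const_inner κ)
  have h2 : Integrable (fun x => ⟪κ, g x⟫) P := hg.const_inner κ
  have h3 : ⟪κ, u⟫ * ∫ x, Real.exp ⟪κ, g x⟫ ∂P =
      ∫ x, (Real.exp ⟪κ, g x⟫ * ⟪κ, g x⟫ - ⟪κ, g x⟫) ∂P := by
    rw [integral_sub h1 h2, integral_inner hg, hmean, inner_zero_right, sub_zero, ← hu,
      ← integral_inner hgκ, integral_tilted, ← integral_mul_const]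
    refine integral_congr_ae (ae_of_all _ fun x => ?_)
    simp only [smul_eq_mul]
    field_simp
  have hnonneg (s : ℝ) : 0 ≤ Real.exp s * s - s ∧ (Real.exp s * s - s = 0 → s = 0) := by
    rcases lt_trichotomy s 0 with hs | rfl | hs
    · have : Real.exp s < 1 := by simpa using hs
      constructor
      · nlinarith
      · intro h
        nlinarith
    · simp
    · have : 1 < Real.exp s := Real.one_lt_exp_iff.2 hs
      constructor
      · nlinarith
      · intro h
        nlinarith
  have h4 : 0 ≤ ⟪κ, u⟫ * ∫ x, Real.exp ⟪κ, g x⟫ ∂P := by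
    rw [h3]
    exact integral_nonneg fun x => (hnonneg _).1
  refine lt_of_le_of_ne (nonneg_of_mul_nonneg_left h4 hZ) fun h0 => hu0 ?_
  rw [← h0, zero_mul, eq_comm, integral_eq_zero_iff_of_nonneg (fun x => (hnonneg _).1)
    (h1.sub h2)] at h3
  have h5 : (fun x => ⟪κ, g x⟫) =ᵐ[P] fun _ => 0 := by
    filter_upwards [h3] with x hx
    exact (hnonneg _).2 hx
  rw [← hu, tilted_congr h5, tilted_const, hmean]

end Interior

/-! ### Differentiability of the posterior -/

section Gibbs

variable {X : Type*} [MeasurableSpace X] {n : ℕ} {P₀ : Measure X}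
  {f : X → EuclideanSpace ℝ (Fin n)} {m₀ lam₀ m : EuclideanSpace ℝ (Fin n)}

lemma tilted_sub_const {μ : Measure X} (φ : X → ℝ) (c : ℝ) :
    μ.tilted (fun x => φ x - c) = μ.tilted φ := by
  simp only [Measure.tilted, Real.exp_sub, integral_div]
  congr with x
  rw [div_div_div_cancel_right₀ (Real.exp_pos c).ne']

/-- Gibbs distributions are tiltings of any one of them, by the features centered there. -/
lemma tilted_gibbs (h : IsGibbsParameter P₀ f m₀ lam₀) (κ : EuclideanSpace ℝ (Fin n)) :
    (gibbs P₀ f lam₀).tilted (fun x => ⟪κ, f x - m₀⟫) = gibbs P₀ f (lam₀ + κ) := by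
  rw [gibbs, tilted_tilted h.integrable_exp, gibbs,
    ← tilted_sub_const (fun x => ⟪lam₀ + κ, f x⟫) ⟪κ, m₀⟫]
  refine congrArg _ (funext fun x => ?_)
  simp only [Pi.add_apply, inner_sub_right, inner_add_left]
  ring

lemma integrable_exp_gibbs_iff (h : IsGibbsParameter P₀ f m₀ lam₀)
    (κ : EuclideanSpace ℝ (Fin n)) :
    Integrable (fun x => Real.exp ⟪κ, f x - m₀⟫) (gibbs P₀ f lam₀) ↔
      Integrable (fun x => Real.exp ⟪lam₀ + κ, f x⟫) P₀ := by
  rw [gibbs, integrable_tilted_iff h.integrable_exp]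
  have : (fun x => Real.exp ⟪lam₀, f x⟫ • Real.exp ⟪κ, f x - m₀⟫) =
      fun x => Real.exp ⟪lam₀ + κ, f x⟫ * Real.exp (-⟪κ, m₀⟫) := by
    ext x
    rw [smul_eq_mul, ← Real.exp_add, ← Real.exp_add, inner_sub_right, inner_add_left]
    ring_nf
  rw [this, integrable_mul_const_iff (Ne.isUnit (Real.exp_pos _).ne')]

lemma isGibbsParameter_add_iff [IsProbabilityMeasure P₀] (h : IsGibbsParameter P₀ f m₀ lam₀)
    (κ : EuclideanSpace ℝ (Fin n)) :
    IsGibbsParameter P₀ f m (lam₀ + κ) ↔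
      Integrable (fun x => Real.exp ⟪κ, f x - m₀⟫) (gibbs P₀ f lam₀) ∧
      Integrable (fun x => f x - m₀) ((gibbs P₀ f lam₀).tilted fun x => ⟪κ, f x - m₀⟫) ∧
      ∫ x, (f x - m₀) ∂((gibbs P₀ f lam₀).tilted fun x => ⟪κ, f x - m₀⟫) = m - m₀ := by
  rw [integrable_exp_gibbs_iff h, tilted_gibbs h]
  constructor
  · intro h'
    have := h'.feasible.isProb
    refine ⟨h'.integrable_exp, h'.feasible.integrable.sub (integrable_const _), ?_⟩
    rw [integral_sub h'.feasible.integrable (integrable_const _), h'.feasible.mean_eq]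
    simp
  · rintro ⟨h1, h2, h3⟩
    have hprob : IsProbabilityMeasure (gibbs P₀ f (lam₀ + κ)) := isProbabilityMeasure_tilted h1
    have h4 : Integrable f (gibbs P₀ f (lam₀ + κ)) := by
      exact (h2.add (integrable_const m₀)).congr (ae_of_all _ fun x => sub_add_cancel _ _)
    refine ⟨h1, hprob, h4, ?_⟩
    rw [integral_sub h4 (integrable_const _)] at h3
    simpa using h3

/-- The compatible vectors form the affine subspace through `m₀` orthogonal to the directions in
which the features are degenerate. -/
lemma mem_compatible_iff (h : IsGibbsParameter P₀ f m₀ lam₀) :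
    m ∈ compatible P₀ f ↔
      m - m₀ ∈ (nullDirections (gibbs P₀ f lam₀) fun x => f x - m₀)ᗮ := by
  have hprob := h.feasible.isProb
  constructor
  · intro hm v hv
    have h1 : ∀ᵐ x ∂P₀, ⟪v, f x⟫ = ⟪v, m₀⟫ := by
      filter_upwards [(absolutelyContinuous_tilted h.integrable_exp).ae_le
        (mem_nullDirections.1 hv)] with x hx
      rwa [inner_sub_right, sub_eq_zero] at hx
    rw [inner_sub_right, hm v _ h1, sub_self]
  · intro hm v c hc
    have h1 : ∀ᵐ x ∂(gibbs P₀ f lam₀), ⟪v, f x⟫ = c :=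
      (tilted_absolutelyContinuous P₀ _).ae_le hc
    have h2 : ⟪v, m₀⟫ = c := by
      rw [← integral_inner_of_isFeasible h.feasible, integral_congr_ae h1]
      simp
    have h3 : v ∈ nullDirections (gibbs P₀ f lam₀) fun x => f x - m₀ := by
      rw [mem_nullDirections]
      filter_upwards [h1] with x hx
      rw [inner_sub_right, hx, h2, sub_self]
    have h4 := hm v h3
    rwa [inner_sub_right, h2, sub_eq_zero] at h4

lemma integral_sub_gibbs (h : IsGibbsParameter P₀ f m₀ lam₀) :
    ∫ x, (f x - m₀) ∂(gibbs P₀ f lam₀) = 0 := by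
  have hprob := h.feasible.isProb
  rw [integral_sub h.feasible.integrable (integrable_const _), h.feasible.mean_eq]
  simp

/-- If the vectors of expected features of Gibbs distributions fill a neighbourhood of `m₀` in the
compatible vectors, then the features have exponential moments under the Gibbs distribution with
mean `m₀`. In every direction `e`, the parameter that moves the mean to `m₀ + t e` shows that the
domain of the normalizing constant reaches beyond `lam₀` in a direction positive on `e`. -/
lemma exists_integrable_exp_mul_norm_gibbs [IsProbabilityMeasure P₀] (hf : Measurable f)
    (hreg : {m | ∃ lam, IsGibbsParameter P₀ f m lam} ∈ 𝓝[compatible P₀ f] m₀)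
    (h : IsGibbsParameter P₀ f m₀ lam₀) :
    ∃ δ > 0, Integrable (fun x => Real.exp (δ * ‖f x - m₀‖)) (gibbs P₀ f lam₀) := by
  have hprob := h.feasible.isProb
  refine exists_integrable_exp_mul_norm (hf.sub_const m₀).aestronglyMeasurable
    ae_mem_orthogonal_nullDirections fun e he he0 => ?_
  have hline : Tendsto (fun t : ℝ => m₀ + t • e) (𝓝[>] 0) (𝓝[compatible P₀ f] m₀) := by
    refine tendsto_nhdsWithin_iff.2 ⟨?_, Eventually.of_forall fun t => ?_⟩
    · have : Continuous fun t : ℝ => m₀ + t • e := by fun_prop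
      simpa using (this.tendsto 0).mono_left (nhdsWithin_le_nhds (s := Set.Ioi 0))
    · rw [mem_compatible_iff h, add_sub_cancel_left]
      exact Submodule.smul_mem _ _ he
  obtain ⟨t, ⟨lam, hlam⟩, ht⟩ := ((hline.eventually hreg).and self_mem_nhdsWithin).exists
  have ht : 0 < t := ht
  rw [← add_sub_cancel lam₀ lam, isGibbsParameter_add_iff h, add_sub_cancel_left] at hlam
  have hpos := inner_mean_tilted_pos (h.feasible.integrable.sub (integrable_const m₀))
    (integral_sub_gibbs h) hlam.1 hlam.2.1 hlam.2.2 (smul_ne_zero ht.ne' he0)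
  rw [real_inner_smul_right] at hpos
  exact ⟨lam - lam₀, hlam.1, pos_of_mul_pos_right hpos ht.le⟩

lemma covOperator_gibbs (h : IsGibbsParameter P₀ f m₀ lam₀)
    (hL2 : MemLp (fun x => f x - m₀) 2 (gibbs P₀ f lam₀)) :
    covOperator (gibbs P₀ f lam₀) (fun x => f x - m₀) =
      Matrix.toEuclideanCLM (𝕜 := ℝ) (featureCov (gibbs P₀ f lam₀) f) := by
  have hprob := h.feasible.isProb
  have hf2 : MemLp f 2 (gibbs P₀ f lam₀) := by
    have h2 := hL2.add (memLp_const m₀)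
    have h3 : (fun x => f x - m₀) + (fun _ => m₀) = f := funext fun x => sub_add_cancel _ _
    rwa [h3] at h2
  ext1 v
  refine ext_inner_left ℝ fun w => ?_
  rw [inner_covOperator hL2, Matrix.inner_toEuclideanCLM,
    ← covariance_inner_eq_dotProduct_mulVec hf2 (S := featureCov (gibbs P₀ f lam₀) f)
      (fun i j => rfl), covariance, integral_inner_of_isFeasible h.feasible,
    integral_inner_of_isFeasible h.feasible]
  simp only [inner_sub_right, mul_comm]

/-- The delta method: near `m₀`, compatible vectors are the expected features of Gibbs
distributions, and the posterior is differentiable at `m₀` in total variation. -/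
theorem exists_posterior_expansion [IsProbabilityMeasure P₀] (hf : Measurable f)
    (hreg : {m | ∃ lam, IsGibbsParameter P₀ f m lam} ∈ 𝓝[compatible P₀ f] m₀)
    (h : IsGibbsParameter P₀ f m₀ lam₀) {G : Matrix (Fin n) (Fin n) ℝ}
    (hG : featureCov (gibbs P₀ f lam₀) f * G * featureCov (gibbs P₀ f lam₀) f =
      featureCov (gibbs P₀ f lam₀) f) {ε : ℝ} (hε : 0 < ε) :
    ∃ r > 0, ∀ m ∈ compatible P₀ f, ‖m - m₀‖ < r →
      (∃ lam, IsGibbsParameter P₀ f m lam) ∧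
      ∀ A, MeasurableSet A →
        |(posterior P₀ f m).real A - (gibbs P₀ f lam₀).real A -
          ⟪Matrix.toEuclideanCLM (𝕜 := ℝ) G (m - m₀), ∫ x in A, (f x - m₀) ∂(gibbs P₀ f lam₀)⟫| ≤
          ε * ‖m - m₀‖ := by
  have hprob := h.feasible.isProb
  obtain ⟨δ, hδ, hexp⟩ := exists_integrable_exp_mul_norm_gibbs hf hreg h
  have hg : AEStronglyMeasurable (fun x => f x - m₀) (gibbs P₀ f lam₀) :=
    (hf.sub_const m₀).aestronglyMeasurable
  have hL2 := memLp_two_of_integrable_exp hg hδ hexp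
  obtain ⟨r, hr, hball⟩ := exists_tilted_expansion hg hδ hexp (integral_sub_gibbs h)
    (G := Matrix.toEuclideanCLM (𝕜 := ℝ) G) (fun w => by
      have h1 := congrArg (fun M => Matrix.toEuclideanCLM (𝕜 := ℝ) M w) hG
      simp only [map_mul] at h1
      rw [covOperator_gibbs h hL2]
      exact h1) hε
  refine ⟨r, hr, fun m hm hmr => ?_⟩
  obtain ⟨θ, h1, h2, h3, h4⟩ := hball (m - m₀) ((mem_compatible_iff h).1 hm) hmr
  have hθ : IsGibbsParameter P₀ f m (lam₀ + θ) := (isGibbsParameter_add_iff h θ).2 ⟨h1, h2, h3⟩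
  refine ⟨⟨_, hθ⟩, fun A hA => ?_⟩
  rw [hθ.posterior_eq_gibbs, ← tilted_gibbs h]
  exact h4 A hA

end Gibbs

/-! ### Continuous mapping in the total variation topology -/

section ContinuousMapping

variable {X E : Type*} [MeasurableSpace X] [NormedAddCommGroup E] {W : E → SignedMeasure X} {C : ℝ}
  {Φ : SignedMeasure X → ℝ}

lemma TVContinuous.continuous_comp (hΦ : TVContinuous Φ) (hC : 0 < C)
    (hW : ∀ z z' A, MeasurableSet A → |W z A - W z' A| ≤ C * ‖z - z'‖) :
    Continuous fun z => Φ (W z) := by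
  refine Metric.continuous_iff.2 fun z ε hε => ?_
  obtain ⟨δ, hδ, h⟩ := hΦ (W z) (ε / 2) (half_pos hε)
  refine ⟨δ / C, div_pos hδ hC, fun z' hz' => ?_⟩
  rw [dist_eq_norm, lt_div_iff₀ hC] at hz'
  rw [Real.dist_eq]
  refine (h _ fun A hA => (hW z' z A hA).trans ?_).trans_lt (half_lt_self hε)
  linarith

/-- A continuous functional is uniformly continuous near the image of a compact set. -/
lemma TVContinuous.exists_forall_mem_compact (hΦ : TVContinuous Φ) (hC : 0 < C)
    (hW : ∀ z z' A, MeasurableSet A → |W z A - W z' A| ≤ C * ‖z - z'‖) {K : Set E}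
    (hK : IsCompact K) {ε : ℝ} (hε : 0 < ε) :
    ∃ δ > 0, ∀ z ∈ K, ∀ ν : SignedMeasure X,
      (∀ A, MeasurableSet A → |ν A - W z A| ≤ δ) → |Φ ν - Φ (W z)| ≤ ε := by
  refine hK.induction_on (p := fun K => ∃ δ > 0, ∀ z ∈ K, ∀ ν : SignedMeasure X,
      (∀ A, MeasurableSet A → |ν A - W z A| ≤ δ) → |Φ ν - Φ (W z)| ≤ ε) ?_ ?_ ?_ ?_
  · exact ⟨1, one_pos, by simp⟩
  · rintro s t hst ⟨δ, hδ, h⟩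
    exact ⟨δ, hδ, fun z hz => h z (hst hz)⟩
  · rintro s t ⟨δ₁, hδ₁, h₁⟩ ⟨δ₂, hδ₂, h₂⟩
    refine ⟨min δ₁ δ₂, lt_min hδ₁ hδ₂, fun z hz ν hν => ?_⟩
    rcases hz with hz | hz
    · exact h₁ z hz ν fun A hA => (hν A hA).trans (min_le_left _ _)
    · exact h₂ z hz ν fun A hA => (hν A hA).trans (min_le_right _ _)
  · intro z₀ _
    obtain ⟨δ, hδ, h⟩ := hΦ (W z₀) (ε / 2) (half_pos hε)
    refine ⟨Metric.ball z₀ (δ / 2 / C), mem_nhdsWithin_of_mem_nhds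
      (Metric.ball_mem_nhds _ (by positivity)), δ / 2, half_pos hδ, fun z hz ν hν => ?_⟩
    rw [mem_ball_iff_norm, lt_div_iff₀ hC] at hz
    have h1 (A : Set X) (hA : MeasurableSet A) : |W z A - W z₀ A| ≤ δ / 2 :=
      (hW z z₀ A hA).trans (by linarith)
    have h2 := h ν fun A hA => by
      calc |ν A - W z₀ A| = |(ν A - W z A) + (W z A - W z₀ A)| := by ring_nf
        _ ≤ |ν A - W z A| + |W z A - W z₀ A| := abs_add_le _ _
        _ ≤ δ / 2 + δ / 2 := add_le_add (hν A hA) (h1 A hA)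
        _ = δ := add_halves δ
    have h3 := h (W z) fun A hA => (h1 A hA).trans (half_le_self hδ.le)
    calc |Φ ν - Φ (W z)| = |(Φ ν - Φ (W z₀)) - (Φ (W z) - Φ (W z₀))| := by ring_nf
      _ ≤ |Φ ν - Φ (W z₀)| + |Φ (W z) - Φ (W z₀)| := abs_sub _ _
      _ ≤ ε / 2 + ε / 2 := add_le_add h2 h3
      _ = ε := add_halves ε

/-- Monotonicity of the lower integral up to a measurable error: neither `F₁` nor `F₂` need be
measurable. -/
lemma lintegral_le_lintegral_add {Ω : Type*} [MeasurableSpace Ω] {Pr : Measure Ω}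
    {F₁ F₂ k : Ω → ℝ≥0∞} {c : ℝ≥0∞} (hk : AEMeasurable k Pr) (hle : ∀ᵐ ω ∂Pr, F₁ ω ≤ F₂ ω + k ω)
    (hc : ∫⁻ ω, k ω ∂Pr ≤ c) : ∫⁻ ω, F₁ ω ∂Pr ≤ ∫⁻ ω, F₂ ω ∂Pr + c := by
  refine (lintegral_mono_ae hle).trans ?_
  rw [lintegral_add_right' _ hk]
  gcongr

/-- An extended continuous mapping theorem: if `Z N` converges in distribution, and `V N`
approaches `W (Z N)` in total variation, uniformly on bounded sets of values of `Z N`, then `V N`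
converges in law to the image under `W` of the limit distribution. No measurability of `V N` is
needed, since `Φ (V N)` and `Φ (W (Z N))` differ by a small measurable function. -/
theorem tendstoInLawTV_of_approx {E Ω : Type*} [NormedAddCommGroup E] [InnerProductSpace ℝ E]
    [FiniteDimensional ℝ E] [MeasurableSpace E] [BorelSpace E] [MeasurableSpace Ω]
    {Pr : Measure Ω} [IsProbabilityMeasure Pr] {μ : Measure E} [IsProbabilityMeasure μ]
    {Z : ℕ → Ω → E} {V : ℕ → Ω → SignedMeasure X} {W : E → SignedMeasure X} {C : ℝ}
    (hZ : TendstoInDistribution Z atTop id (fun _ => Pr) μ) (hC : 0 < C)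
    (hW : ∀ z z' A, MeasurableSet A → |W z A - W z' A| ≤ C * ‖z - z'‖)
    (hV : ∀ R : ℝ, ∀ δ > 0, ∀ᶠ N in atTop, ∀ᵐ ω ∂Pr, ‖Z N ω‖ ≤ R →
      ∀ A, MeasurableSet A → |V N ω A - W (Z N ω) A| ≤ δ) :
    TendstoInLawTV V Pr W μ := by
  refine ⟨fun Φ hΦ => (hΦ.continuous_comp hC hW).measurable.aemeasurable, fun Φ c hΦ hΦc => ?_⟩
  have hcont := hΦ.continuous_comp hC hW
  have hc0 : 0 ≤ c := (hΦc 0).1.trans (hΦc 0).2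
  set Ψ : E → ℝ≥0∞ := fun z => ENNReal.ofReal (Φ (W z)) with hΨ
  -- convergence with `W (Z N)` in place of `V N`
  have hlim : Tendsto (fun N => ∫⁻ ω, Ψ (Z N ω) ∂Pr) atTop (𝓝 (∫⁻ z, Ψ z ∂μ)) := by
    have h := (ProbabilityMeasure.tendsto_iff_forall_lintegral_tendsto.1 hZ.tendsto)
      (BoundedContinuousFunction.mkOfBound ⟨fun z => (Φ (W z)).toNNReal,
        continuous_real_toNNReal.comp hcont⟩ c (fun z z' => by
          rw [NNReal.dist_eq]
          simp only [ContinuousMap.coe_mk, Real.coe_toNNReal _ (hΦc _).1]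
          rw [abs_le]
          constructor <;> linarith [(hΦc (W z)).1, (hΦc (W z)).2, (hΦc (W z')).1, (hΦc (W z')).2]))
    have hmeas : Measurable Ψ := ENNReal.measurable_ofReal.comp hcont.measurable
    simp only [ProbabilityMeasure.coe_mk, Measure.map_id] at h
    refine Tendsto.congr (fun N => ?_) h
    exact lintegral_map' hmeas.aemeasurable (hZ.forall_aemeasurable N)
  have hfin : ∫⁻ z, Ψ z ∂μ ≠ ∞ := by
    refine ne_top_of_le_ne_top (b := ENNReal.ofReal c) ENNReal.ofReal_ne_top ?_
    calc ∫⁻ z, Ψ z ∂μ ≤ ∫⁻ _, ENNReal.ofReal c ∂μ :=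
          lintegral_mono fun z => ENNReal.ofReal_le_ofReal (hΦc _).2
      _ = ENNReal.ofReal c := by simp
  have hclose (ε : ℝ) (hε : 0 < ε) : ∀ᶠ N in atTop,
      ∫⁻ ω, ENNReal.ofReal (Φ (V N ω)) ∂Pr ≤ ∫⁻ ω, Ψ (Z N ω) ∂Pr + ENNReal.ofReal ε ∧
      ∫⁻ ω, Ψ (Z N ω) ∂Pr ≤ ∫⁻ ω, ENNReal.ofReal (Φ (V N ω)) ∂Pr + ENNReal.ofReal ε := by
    obtain ⟨R, hR⟩ := exists_measure_norm_gt_le_of_tendstoInDistribution hZ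
      (ε := ENNReal.ofReal (ε / (2 * (c + 1)))) (ENNReal.ofReal_pos.2 (by positivity))
    obtain ⟨δ, hδ, hunif⟩ := hΦ.exists_forall_mem_compact hC hW
      (isCompact_closedBall (0 : E) R) (half_pos hε)
    filter_upwards [hV R δ hδ] with N hN
    have hset : NullMeasurableSet {ω | R < ‖Z N ω‖} Pr :=
      nullMeasurableSet_lt aemeasurable_const (hZ.forall_aemeasurable N).norm
    -- outside a bounded set, whose complement has small probability, `Φ ≤ c` is all that is used
    set k : Ω → ℝ≥0∞ := fun ω =>
      ENNReal.ofReal (ε / 2) + {ω | R < ‖Z N ω‖}.indicator (fun _ => ENNReal.ofReal c) ω with hk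
    have hkmeas : AEMeasurable k Pr :=
      (aemeasurable_const.indicator₀ hset).const_add _
    have hkint : ∫⁻ ω, k ω ∂Pr ≤ ENNReal.ofReal ε := by
      rw [hk, lintegral_add_left measurable_const, lintegral_const, measure_univ, mul_one,
        lintegral_indicator_const₀ hset]
      calc _ ≤ ENNReal.ofReal (ε / 2) +
            ENNReal.ofReal c * ENNReal.ofReal (ε / (2 * (c + 1))) := by gcongr; exact hR N
        _ = ENNReal.ofReal (ε / 2 + c * (ε / (2 * (c + 1)))) := by
            rw [← ENNReal.ofReal_mul hc0, ← ENNReal.ofReal_add (by positivity) (by positivity)]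
        _ ≤ ENNReal.ofReal ε := by
            refine ENNReal.ofReal_le_ofReal ?_
            have : c * (ε / (2 * (c + 1))) ≤ ε / 2 := by
              rw [mul_div_assoc', div_le_div_iff₀ (by positivity) (by positivity)]
              nlinarith
            linarith
    have hpt : ∀ᵐ ω ∂Pr, ENNReal.ofReal (Φ (V N ω)) ≤ Ψ (Z N ω) + k ω ∧
        Ψ (Z N ω) ≤ ENNReal.ofReal (Φ (V N ω)) + k ω := by
      filter_upwards [hN] with ω hω
      by_cases hωR : R < ‖Z N ω‖
      · have hkω : ENNReal.ofReal c ≤ k ω := by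
          simp only [hk, Set.indicator_of_mem (show ω ∈ {ω | R < ‖Z N ω‖} from hωR)]
          exact le_add_self
        have hle (ν : SignedMeasure X) : ENNReal.ofReal (Φ ν) ≤ k ω :=
          (ENNReal.ofReal_le_ofReal (hΦc ν).2).trans hkω
        exact ⟨le_add_left (hle _), le_add_left (hle _)⟩
      · have hωR' := not_lt.1 hωR
        have h1 := hunif (Z N ω) (by simpa using hωR') (V N ω) (hω hωR')
        rw [abs_le] at h1
        have hkω : ENNReal.ofReal (ε / 2) ≤ k ω := le_self_add
        constructor
        · calc ENNReal.ofReal (Φ (V N ω)) ≤ ENNReal.ofReal (Φ (W (Z N ω)) + ε / 2) :=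
                ENNReal.ofReal_le_ofReal (by linarith)
            _ ≤ Ψ (Z N ω) + ENNReal.ofReal (ε / 2) := ENNReal.ofReal_add_le
            _ ≤ _ := by gcongr
        · calc Ψ (Z N ω) ≤ ENNReal.ofReal (Φ (V N ω) + ε / 2) :=
                ENNReal.ofReal_le_ofReal (by linarith)
            _ ≤ ENNReal.ofReal (Φ (V N ω)) + ENNReal.ofReal (ε / 2) := ENNReal.ofReal_add_le
            _ ≤ _ := by gcongr
    exact ⟨lintegral_le_lintegral_add hkmeas (hpt.mono fun _ h => h.1) hkint,
      lintegral_le_lintegral_add hkmeas (hpt.mono fun _ h => h.2) hkint⟩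
  refine (ENNReal.tendsto_nhds hfin).2 fun ε hε => ?_
  obtain ⟨η, hη0, hηε⟩ : ∃ η : ℝ, 0 < η ∧ ENNReal.ofReal η ≤ ε / 2 := by
    obtain ⟨η, hη0, hη⟩ := ENNReal.lt_iff_exists_nnreal_btwn.1 (ENNReal.half_pos hε.ne')
    refine ⟨η, by exact_mod_cast hη0, ?_⟩
    rw [ENNReal.ofReal_coe_nnreal]
    exact hη.le
  filter_upwards [hclose η hη0,
    (ENNReal.tendsto_nhds hfin).1 hlim (ε / 2) (ENNReal.half_pos hε.ne')] with N h1 h2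
  have h3 := tsub_le_iff_right.1 h2.1
  constructor
  · rw [tsub_le_iff_right]
    calc ∫⁻ z, Ψ z ∂μ ≤ ∫⁻ ω, Ψ (Z N ω) ∂Pr + ε / 2 := h3
      _ ≤ (∫⁻ ω, ENNReal.ofReal (Φ (V N ω)) ∂Pr + ε / 2) + ε / 2 := by
          gcongr; exact h1.2.trans (by gcongr)
      _ = _ := by rw [add_assoc, ENNReal.add_halves]
  · calc _ ≤ ∫⁻ ω, Ψ (Z N ω) ∂Pr + ε / 2 := h1.1.trans (by gcongr)
      _ ≤ (∫⁻ z, Ψ z ∂μ + ε / 2) + ε / 2 := by gcongr; exact h2.2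
      _ = _ := by rw [add_assoc, ENNReal.add_halves]

end ContinuousMapping

/-! ### The limiting Gaussian signed measure -/

section Limit

variable {X : Type*} [MeasurableSpace X] {n : ℕ} {P : Measure X}
  {f : X → EuclideanSpace ℝ (Fin n)} {m : EuclideanSpace ℝ (Fin n)}
  {G S : Matrix (Fin n) (Fin n) ℝ}

/-- The signed measure `⟪G z, f - m⟫ P`, the total variation derivative of the posterior at `m` in
the direction `z`; with `z` Gaussian it is the limit in law. -/
def limitMeasure (P : Measure X) (f : X → EuclideanSpace ℝ (Fin n))
    (m : EuclideanSpace ℝ (Fin n)) (G : Matrix (Fin n) (Fin n) ℝ)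
    (z : EuclideanSpace ℝ (Fin n)) : SignedMeasure X :=
  P.withDensityᵥ fun x => ⟪Matrix.toEuclideanCLM (𝕜 := ℝ) G z, f x - m⟫

lemma limitMeasure_apply (hint : Integrable (fun x => f x - m) P) (z : EuclideanSpace ℝ (Fin n))
    {A : Set X} (hA : MeasurableSet A) :
    limitMeasure P f m G z A =
      ⟪Matrix.toEuclideanCLM (𝕜 := ℝ) G z, ∫ x in A, (f x - m) ∂P⟫ := by
  rw [limitMeasure, withDensityᵥ_apply (hint.const_inner _) hA,
    integral_inner hint.integrableOn]

lemma exists_lipschitz_limitMeasure (hint : Integrable (fun x => f x - m) P) :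
    ∃ C > 0, ∀ z z' A, MeasurableSet A →
      |limitMeasure P f m G z A - limitMeasure P f m G z' A| ≤ C * ‖z - z'‖ := by
  set T := Matrix.toEuclideanCLM (𝕜 := ℝ) G
  refine ⟨(‖T‖ + 1) * ((∫ x, ‖f x - m‖ ∂P) + 1), ?_, fun z z' A hA => ?_⟩
  · have : 0 ≤ ∫ x, ‖f x - m‖ ∂P := integral_nonneg fun x => norm_nonneg _
    positivity
  have hh : ‖∫ x in A, (f x - m) ∂P‖ ≤ ∫ x, ‖f x - m‖ ∂P :=
    (norm_integral_le_integral_norm _).trans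
      (setIntegral_le_integral hint.norm (ae_of_all _ fun x => norm_nonneg _))
  rw [limitMeasure_apply hint z hA, limitMeasure_apply hint z' hA, ← inner_sub_left, ← map_sub]
  calc |⟪T (z - z'), ∫ x in A, (f x - m) ∂P⟫|
      ≤ ‖T (z - z')‖ * ‖∫ x in A, (f x - m) ∂P‖ := abs_real_inner_le_norm _ _
    _ ≤ ((‖T‖ + 1) * ‖z - z'‖) * ((∫ x, ‖f x - m‖ ∂P) + 1) := by
        gcongr
        · exact (T.le_opNorm _).trans (by gcongr; linarith)
        · linarith
    _ = _ := by ring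

lemma ofLp_setIntegral_eq_partialMoment (hint : Integrable (fun x => f x - m) P) (A : Set X) :
    (∫ x in A, (f x - m) ∂P).ofLp = partialMoment P f m A := by
  ext i
  have h := (EuclideanSpace.proj (𝕜 := ℝ) i).integral_comp_comm (hint.integrableOn (s := A))
  exact h.symm

/-- The image of a Gaussian vector under the linear map `limitMeasure` is a Gaussian random
signed measure: its values are linear functionals of the vector. -/
theorem isGaussianSignedMeasure_limitMeasure (hint : Integrable (fun x => f x - m) P)
    (hS : S.PosSemidef) :
    IsGaussianSignedMeasure (limitMeasure P f m G) (multivariateGaussian 0 S)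
      (covKernel P f m G S) := by
  set T := Matrix.toEuclideanCLM (𝕜 := ℝ) G
  set h : Set X → EuclideanSpace ℝ (Fin n) := fun A => ∫ x in A, (f x - m) ∂P with hh
  set a : Set X → EuclideanSpace ℝ (Fin n) := fun A => T.adjoint (h A) with ha
  have hval (A : Set X) (hA : MeasurableSet A) :
      (fun z => limitMeasure P f m G z A) = fun z => innerSL ℝ (a A) z := by
    ext z
    rw [limitMeasure_apply hint z hA, innerSL_apply_apply, ha,
      ContinuousLinearMap.adjoint_inner_left, real_inner_comm]
  have haG (A : Set X) : (a A).ofLp = Gᵀ *ᵥ partialMoment P f m A := by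
    have h1 : T.adjoint = Matrix.toEuclideanCLM (𝕜 := ℝ) Gᵀ := by
      rw [← ContinuousLinearMap.star_eq_adjoint, ← map_star, Matrix.star_eq_conjTranspose,
        Matrix.conjTranspose_eq_transpose_of_trivial]
    rw [ha, h1, ← ofLp_setIntegral_eq_partialMoment hint]
    simp [hh, Matrix.ofLp_toEuclideanCLM]
  have hcov (A B : Set X) (hA : MeasurableSet A) (hB : MeasurableSet B) :
      cov[fun z => limitMeasure P f m G z A, fun z => limitMeasure P f m G z B;
        multivariateGaussian 0 S] = covKernel P f m G S A B := by
    rw [hval A hA, hval B hB]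
    simp only [innerSL_apply_apply]
    rw [← covarianceBilin_apply_eq_cov IsGaussian.memLp_two_id,
      covarianceBilin_multivariateGaussian hS, haG, haG, covKernel, Matrix.mulVec_mulVec,
      Matrix.mulVec_transpose, ← Matrix.dotProduct_mulVec, Matrix.mulVec_mulVec, Matrix.mul_assoc]
  refine ⟨⟨fun I => ?_⟩, fun A hA => ?_, hcov⟩
  · have h1 := (IsGaussian.hasGaussianLaw_id (μ := multivariateGaussian 0 S)).map_of_measurable
      (ContinuousLinearMap.pi fun A : I => innerSL ℝ (a A.1.1)) (by fun_prop)
    exact h1.congr (ae_of_all _ fun z => funext fun A => (congrFun (hval A.1.1 A.1.2) z).symm)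
  · refine ⟨?_, ?_⟩
    · rw [hval A hA]; fun_prop
    · have h2 := hcov A A hA hA
      rw [hval A hA] at h2 ⊢
      rw [covariance_self (by fun_prop)] at h2
      rw [IsGaussian.map_eq_gaussianReal, h2,
        ContinuousLinearMap.integral_comp_id_comm IsGaussian.integrable_id,
        integral_id_multivariateGaussian, map_zero]

end Limit

/-! ### Sample averages of compatible vectors -/

section Sample

variable {X Ω : Type*} [MeasurableSpace X] [MeasurableSpace Ω] {n : ℕ} {P₀ : Measure X}
  {f : X → EuclideanSpace ℝ (Fin n)} {Pr : Measure Ω} {Y : ℕ → Ω → EuclideanSpace ℝ (Fin n)}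

lemma isClosed_compatible : IsClosed (compatible P₀ f) := by
  simp only [compatible, Set.ofPred_forall]
  exact isClosed_iInter fun v => isClosed_iInter fun c => isClosed_iInter fun _ =>
    isClosed_eq (by fun_prop) continuous_const

lemma sampleAverage_mem_compatible {y : ℕ → EuclideanSpace ℝ (Fin n)}
    (hy : ∀ k, y k ∈ compatible P₀ f) {N : ℕ} (hN : N ≠ 0) :
    sampleAverage y N ∈ compatible P₀ f := by
  intro v c hc
  rw [sampleAverage, inner_smul_right, inner_sum,
    Finset.sum_congr rfl fun k _ => hy k v c hc]
  have : (N : ℝ) ≠ 0 := by exact_mod_cast hN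
  simp [this]

/-- The case `N = 0` is excluded because the empty average is `0`, which need not be compatible. -/
lemma ae_sampleAverage_mem_compatible (hident : ∀ k, IdentDistrib (Y k) (Y 0) Pr Pr)
    (hcompat : ∀ᵐ ω ∂Pr, Y 0 ω ∈ compatible P₀ f) :
    ∀ᵐ ω ∂Pr, ∀ N ≠ 0, sampleAverage (fun k => Y k ω) N ∈ compatible P₀ f := by
  have h (k : ℕ) : ∀ᵐ ω ∂Pr, Y k ω ∈ compatible P₀ f :=
    (hident k).symm.ae_mem_snd isClosed_compatible.measurableSet hcompat
  filter_upwards [ae_all_iff.2 h] with ω hω N hN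
  exact sampleAverage_mem_compatible hω hN

end Sample

end MaxEntPosterior

end

open MaxEntPosterior in
theorem mainTheorem4
    {X : Type*} [MeasurableSpace X] {n : ℕ}
    -- the prior, the features, the true world
    (P₀ : Measure X) [IsProbabilityMeasure P₀]
    (f : X → EuclideanSpace ℝ (Fin n)) (hf : Measurable f) (x₀ : X)
    -- every vector close to `f x₀` that respects the affine relations between the features
    -- is the vector of expected features of a Gibbs distribution
    (hreg : {m | ∃ lam, MaxEntPosterior.IsGibbsParameter P₀ f m lam} ∈
      𝓝[MaxEntPosterior.compatible P₀ f] (f x₀))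
    -- `P_∞` is the Gibbs distribution with vector of expected features `f x₀`
    (lamInf : EuclideanSpace ℝ (Fin n))
    (hlamInf : MaxEntPosterior.IsGibbsParameter P₀ f (f x₀) lamInf)
    -- the data `D₁, D₂, …` and the estimator applied to each of them
    {Δ Ω : Type*} [MeasurableSpace Ω] (Pr : Measure Ω) [IsProbabilityMeasure Pr]
    (D : ℕ → Ω → Δ) (muHat : Δ → EuclideanSpace ℝ (Fin n))
    (hindep : iIndepFun (fun k ω => muHat (D k ω)) Pr)
    (hident : ∀ k, IdentDistrib (fun ω => muHat (D k ω)) (fun ω => muHat (D 0 ω)) Pr Pr)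
    (hL2 : MemLp (fun ω => muHat (D 0 ω)) 2 Pr)
    (hunbiased : ∫ ω, muHat (D 0 ω) ∂Pr = f x₀)
    (S : Matrix (Fin n) (Fin n) ℝ)
    (hS : ∀ i j, cov[fun ω => muHat (D 0 ω) i, fun ω => muHat (D 0 ω) j; Pr] = S i j)
    (hcompat : ∀ᵐ ω ∂Pr, muHat (D 0 ω) ∈ MaxEntPosterior.compatible P₀ f)
    -- a generalized inverse of the covariance matrix of the features under `P_∞`
    -- (the inverse, if that matrix is invertible)
    (G : Matrix (Fin n) (Fin n) ℝ)
    (hG : MaxEntPosterior.featureCov (MaxEntPosterior.gibbs P₀ f lamInf) f * G *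
        MaxEntPosterior.featureCov (MaxEntPosterior.gibbs P₀ f lamInf) f =
      MaxEntPosterior.featureCov (MaxEntPosterior.gibbs P₀ f lamInf) f) :
    TendstoInDistribution
      (fun (N : ℕ) ω =>
        √(N : ℝ) • (MaxEntPosterior.sampleAverage (fun k => muHat (D k ω)) N - f x₀))
      atTop id (fun _ => Pr) (multivariateGaussian 0 S) ∧
    Tendsto
      (fun N : ℕ => Pr {ω | ¬ ∃! P, MaxEntPosterior.IsMinimizer P₀ f
        (MaxEntPosterior.sampleAverage (fun k => muHat (D k ω)) N) P})
      atTop (𝓝 0) ∧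
    ∃ (Ω' : Type) (_ : MeasurableSpace Ω') (Pr' : Measure Ω') (_ : IsProbabilityMeasure Pr')
      (W : Ω' → SignedMeasure X),
      MaxEntPosterior.IsGaussianSignedMeasure W Pr'
        (MaxEntPosterior.covKernel (MaxEntPosterior.gibbs P₀ f lamInf) f (f x₀) G S) ∧
      MaxEntPosterior.TendstoInLawTV
        (fun (N : ℕ) ω => √(N : ℝ) •
          ((MaxEntPosterior.posterior P₀ f
              (MaxEntPosterior.sampleAverage (fun k => muHat (D k ω)) N)).toSignedMeasure -
            (MaxEntPosterior.gibbs P₀ f lamInf).toSignedMeasure))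
        Pr W Pr' := by
  have hprob := hlamInf.feasible.isProb
  have hint : Integrable (fun x => f x - f x₀) (gibbs P₀ f lamInf) :=
    hlamInf.feasible.integrable.sub (integrable_const _)
  have hclt := tendstoInDistribution_sampleAverage hindep hident hL2 hS
  rw [hunbiased] at hclt
  have hae := ae_sampleAverage_mem_compatible hident hcompat
  -- on bounded sets of values of the rescaled average, the average is close to `f x₀`
  have hnear (R r : ℝ) (hr : 0 < r) : ∀ᶠ N : ℕ in atTop, N ≠ 0 ∧
      ∀ z : EuclideanSpace ℝ (Fin n), ‖√(N : ℝ) • z‖ ≤ R → ‖z‖ < r := by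
    have hsqrt : Tendsto (fun N : ℕ => √(N : ℝ)) atTop atTop :=
      Real.tendsto_sqrt_atTop.comp tendsto_natCast_atTop_atTop
    filter_upwards [hsqrt.eventually_gt_atTop (R / r), eventually_ne_atTop 0] with N hN hN0
    refine ⟨hN0, fun z hz => ?_⟩
    have hpos : 0 < √(N : ℝ) := Real.sqrt_pos.2 (by positivity)
    rw [norm_smul, Real.norm_of_nonneg hpos.le] at hz
    rw [div_lt_iff₀ hr] at hN
    exact lt_of_mul_lt_mul_left (hz.trans_lt hN) hpos.le
  refine ⟨hclt, ?_, EuclideanSpace ℝ (Fin n), inferInstance, multivariateGaussian 0 S,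
    inferInstance, limitMeasure (gibbs P₀ f lamInf) f (f x₀) G,
    isGaussianSignedMeasure_limitMeasure hint (posSemidef_of_covariance hL2 hS), ?_⟩
  · obtain ⟨r, hr, hball⟩ := exists_posterior_expansion hf hreg hlamInf hG one_pos
    refine (ENNReal.tendsto_nhds ENNReal.zero_ne_top).2 fun ε hε => ?_
    obtain ⟨R, hR⟩ := exists_measure_norm_gt_le_of_tendstoInDistribution hclt hε
    filter_upwards [hnear R r hr] with N hN
    refine ⟨by simp, le_trans (measure_mono_ae ?_) ((hR N).trans (by simp))⟩
    filter_upwards [hae] with ω hω hnot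
    refine lt_of_not_ge fun hle => hnot ?_
    obtain ⟨lam, hlam⟩ := (hball _ (hω N hN.1) (hN.2 _ hle)).1
    exact hlam.existsUnique_isMinimizer
  · obtain ⟨C, hC, hlip⟩ := exists_lipschitz_limitMeasure (G := G) hint
    refine tendstoInLawTV_of_approx hclt hC hlip fun R δ hδ => ?_
    obtain ⟨r, hr, hball⟩ := exists_posterior_expansion hf hreg hlamInf hG
      (ε := δ / (|R| + 1)) (by positivity)
    filter_upwards [hnear R r hr] with N hN
    filter_upwards [hae] with ω hω hle A hA
    have h := (hball _ (hω N hN.1) (hN.2 _ hle)).2 A hA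
    set y := sampleAverage (fun k => muHat (D k ω)) N
    rw [limitMeasure_apply hint _ hA, map_smul, real_inner_smul_left]
    simp only [FunLike.coe_smul, Pi.smul_apply, FunLike.coe_sub, Pi.sub_apply,
      Measure.toSignedMeasure_apply_measurable hA, smul_eq_mul]
    rw [← mul_sub, abs_mul, abs_of_nonneg (Real.sqrt_nonneg _)]
    rw [norm_smul, Real.norm_of_nonneg (Real.sqrt_nonneg _)] at hle
    calc √(N : ℝ) * _ ≤ √(N : ℝ) * (δ / (|R| + 1) * ‖y - f x₀‖) := by gcongr
      _ = δ / (|R| + 1) * (√(N : ℝ) * ‖y - f x₀‖) := by ring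
      _ ≤ δ / (|R| + 1) * (|R| + 1) := by gcongr; linarith [le_abs_self R]
      _ = δ := by field_simp
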